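/- Let $\mathcal S_1,\mathcal S_2,\mathcal X_1,\mathcal X_2,\mathcal Y,\hat{\mathcal S}_1,\hat{\mathcal S}_2$ be finite alphabets, let $(S_1,S_2)$ have joint distribution $p(s_1,s_2)$ on $\mathcal S_1\times\mathcal S_2$, let $p(y|x_1,x_2)$ be a discrete memoryless multiple access channel from $\mathcal X_1\times\mathcal X_2$ to $\mathcal Y$, let $d_j:\mathcal S_j\times\hat{\mathcal S}_j\to\mathbb R$ $(j=1,2)$ be distortion measures, and let $D_1,D_2\in\mathbb R$. A code of length $n$ consists of encoders $e_j:\mathcal S_j^n\to\mathcal X_j^n$ and decoding functions $g_j:\mathcal Y^n\to\hat{\mathcal S}_j^n$, $j=1,2$. The pairs $(S_{1i},S_{2i})$, $i=1,\dots,n$, are i.i.d. copies of $(S_1,S_2)$; given $(S_1^n,S_2^n)$, the output $Y^n$ has distribution $\prod_{i=1}^n p(y_i|x_{1i},x_{2i})$ with $x_j^n=e_j(S_j^n)$; and $\hat S_j^n=g_j(Y^n)$. There is no side information. The pair $(D_1,D_2)$ is achievable if for every $\varepsilon>0$ and all sufficiently large $n$ there is a code of length $n$ with $\frac1n\sum_{i=1}^n\mathbb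 E[d_j(S_{ji},\hat S_{ji})]\le D_j+\varepsilon$ for $j=1,2$. For a discrete random variable $Z$ jointly distributed with $(S_1,S_2)$ put $$R_{S_j|Z}(D_j)=\inf\ I(S_j;U_j|Z),$$ the infimum being over all finite-alphabet conditional distributions $p(u_j|s_j,z)$ with $\min_f\mathbb E[d_j(S_j,f(U_j,Z))]\le D_j$, where $f$ ranges over the functions of $(U_j,Z)$ with values in $\hat{\mathcal S}_j$, and put $$R_{S_1S_2}(D_1,D_2)=\inf\ I(S_1,S_2;\hat S_1,\hat S_2),$$ the infimum being over all $p(\hat s_1,\hat s_2|s_1,s_2)$ with $\mathbb E[d_j(S_j,\hat S_j)]\le D_j$ for $j=1,2$. An infimum over the empty set is $+\infty$, and all information quantities use one fixed base of the logarithm. Theorem. Suppose that $(D_1,D_2)$ is achievable for the sources $(S_1,S_2)$ and the channel $p(y|x_1,x_2)$. Then for every discrete random variable $Z$, jointly distributed with $(S_1,S_2)$, such that $S_1-Z-S_2$ is a Markov chain, there are random variables $X_1\in\mathcal X_1$, $X_2\in\mathcal X_2$ and a finite-valued $Q$ such that $X_1-Q-X_2$ is a Markov chain and, with joint distribution $p(q)\,p(x_1|q)\,p(x_2|q)\,p(y|x_1,x_2)$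 of $(Q,X_1,X_2,Y)$, \begin{align*} R_{S_1|Z}(D_1)&\le I(X_1;Y|X_2,Q),\\ R_{S_2|Z}(D_2)&\le I(X_2;Y|X_1,Q),\\ R_{S_1|Z}(D_1)+R_{S_2|Z}(D_2)&\le I(X_1,X_2;Y|Q),\\ R_{S_1S_2}(D_1,D_2)&\le I(X_1,X_2;Y). \end{align*} -/

import Mathlib

noncomputable section

namespace MAC

open scoped BigOperators

/-! ### Discrete probability

A discrete probability space is a type `Ω` with `P : PMF Ω`; a discrete random variable is a
function on `Ω`. -/

/-- `P(X = a)` as a real number. -/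
def prob {Ω A : Type*} (P : PMF Ω) (X : Ω → A) (a : A) : ℝ := ((P.map X) a).toReal

/-- The expectation `E[g]`; in this development `g` always takes finitely many values. -/
def expect {Ω : Type*} (P : PMF Ω) (g : Ω → ℝ) : ℝ := ∑' ω, (P ω).toReal * g ω

/-- The joint law `p(a) κ(b | a)`. -/
def joint {A B : Type*} (P : PMF A) (κ : A → PMF B) : PMF (A × B) :=
  P.bind fun a => (κ a).map fun b => (a, b)

/-- The law of `n` independent letters, the `i`-th one distributed according to `p i`. -/
def prodPMF {A : Type*} [Fintype A] {n : ℕ} (p : Fin n → PMF A) : PMF (Fin n → A) :=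
  PMF.ofFintype (fun x => ∏ i, p i (x i)) (by
    classical
    rw [← Fintype.prod_sum (fun i a => p i a)]
    refine Finset.prod_eq_one fun i _ => ?_
    exact (tsum_fintype _).symm.trans (p i).tsum_coe)

/-- The Markov chain `X - Z - Y`: `X` and `Y` are conditionally independent given `Z`, i.e.
`p(x, y, z) p(z) = p(x, z) p(y, z)`. -/
def IsMarkovChain {Ω A C B : Type*} (P : PMF Ω) (X : Ω → A) (Z : Ω → C) (Y : Ω → B) : Prop :=
  ∀ a c b, prob P (fun ω => (X ω, Y ω, Z ω)) (a, b, c) * prob P Z c =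
    prob P (fun ω => (X ω, Z ω)) (a, c) * prob P (fun ω => (Y ω, Z ω)) (b, c)

/-! ### Information measures (in nats) -/

/-- The mutual information `I(X; Y)` of random variables with finite alphabets. -/
def mutualInfo {Ω A B : Type*} [Fintype A] [Fintype B] (P : PMF Ω) (X : Ω → A) (Y : Ω → B) : ℝ :=
  ∑ a, ∑ b, prob P (fun ω => (X ω, Y ω)) (a, b) *
    Real.log (prob P (fun ω => (X ω, Y ω)) (a, b) / (prob P X a * prob P Y b))

/-- The conditional mutual information `I(X; Y | Z)` of random variables `X`, `Y` with finite
alphabets given a discrete random variable `Z`. -/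
def condMutualInfo {Ω A B C : Type*} [Fintype A] [Fintype B] (P : PMF Ω)
    (X : Ω → A) (Y : Ω → B) (Z : Ω → C) : ℝ :=
  ∑' c, ∑ a, ∑ b, prob P (fun ω => (X ω, Y ω, Z ω)) (a, b, c) *
    Real.log (prob P (fun ω => (X ω, Y ω, Z ω)) (a, b, c) * prob P Z c /
      (prob P (fun ω => (X ω, Z ω)) (a, c) * prob P (fun ω => (Y ω, Z ω)) (b, c)))

/-! ### Rate distortion functions

Values are extended reals, so that the infimum over an empty set of test channels is `⊤`. -/

/-- The minimum average distortion `𝓔(S | Q) = min_f E[d(S, f(Q))]` of `S` given `Q`. -/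
def minDistortion {Ω S T Q : Type*} (P : PMF Ω) (d : S → T → ℝ) (X : Ω → S) (V : Ω → Q) : EReal :=
  ⨅ f : Q → T, ((expect P fun ω => d (X ω) (f (V ω)) : ℝ) : EReal)

/-- The conditional rate distortion function `R_{S|Z}(D)`, for the joint law `P` of `(S, Z)`: the
least `I(S; U | Z)` over the test channels `p(u | s, z)` with `𝓔(S | U, Z) ≤ D`. -/
def condRateDistortion {S T Z : Type*} [Fintype S] (P : PMF (S × Z)) (d : S → T → ℝ) (D : ℝ) :
    EReal :=
  ⨅ (m : ℕ) (κ : S × Z → PMF (Fin m))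
    (_ : minDistortion (joint P κ) d (fun ω => ω.1.1) (fun ω => (ω.2, ω.1.2)) ≤ (D : EReal)),
    ((condMutualInfo (joint P κ) (fun ω => ω.1.1) (fun ω => ω.2) (fun ω => ω.1.2) : ℝ) : EReal)

/-- The rate distortion function `R_{S₁S₂}(D₁, D₂)` of the joint source `(S₁, S₂)`: the least
`I(S₁, S₂; Ŝ₁, Ŝ₂)` over the test channels `p(ŝ₁, ŝ₂ | s₁, s₂)` with `E[dⱼ(Sⱼ, Ŝⱼ)] ≤ Dⱼ`. -/
def jointRateDistortion {S₁ S₂ T₁ T₂ : Type*} [Fintype S₁] [Fintype S₂] [Fintype T₁] [Fintype T₂]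
    (P : PMF (S₁ × S₂)) (d₁ : S₁ → T₁ → ℝ) (d₂ : S₂ → T₂ → ℝ) (D₁ D₂ : ℝ) : EReal :=
  ⨅ (κ : S₁ × S₂ → PMF (T₁ × T₂))
    (_ : expect (joint P κ) (fun ω => d₁ ω.1.1 ω.2.1) ≤ D₁)
    (_ : expect (joint P κ) (fun ω => d₂ ω.1.2 ω.2.2) ≤ D₂),
    ((mutualInfo (joint P κ) (fun ω => ω.1) (fun ω => ω.2) : ℝ) : EReal)

/-! ### Codes for two sources over a multiple access channel, without side information -/

/-- The joint law `p(x₁, x₂, q) W(y | x₁, x₂)` of `(((X₁, X₂), Q), Y)`, where `Y` is the output of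
the channel `W` for the inputs `(X₁, X₂)`. -/
def channelLaw {X₁ X₂ Y Q : Type*} (P : PMF ((X₁ × X₂) × Q)) (W : X₁ × X₂ → PMF Y) :
    PMF (((X₁ × X₂) × Q) × Y) :=
  joint P fun ω => W ω.1

/-- A block code of length `n`: two encoders, each of which sees its own source only, and a decoder
(one function per source) that sees the channel output only. -/
structure Code (S₁ S₂ X₁ X₂ Y T₁ T₂ : Type*) (n : ℕ) where
  enc₁ : (Fin n → S₁) → (Fin n → X₁)
  enc₂ : (Fin n → S₂) → (Fin n → X₂)
  dec₁ : (Fin n → Y) → (Fin n → T₁)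
  dec₂ : (Fin n → Y) → (Fin n → T₂)

section

variable {S₁ S₂ X₁ X₂ Y T₁ T₂ : Type*} [Fintype S₁] [Fintype S₂] [Fintype Y] {n : ℕ}

/-- The joint law of the source block `(S₁ⁿ, S₂ⁿ)`, which is i.i.d. with letter law `p`, and of the
output block `Yⁿ` of the memoryless channel `W`, whose inputs are the encoded source blocks. -/
def Code.law (c : Code S₁ S₂ X₁ X₂ Y T₁ T₂ n) (p : PMF (S₁ × S₂)) (W : X₁ × X₂ → PMF Y) :
    PMF ((Fin n → S₁ × S₂) × (Fin n → Y)) :=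
  joint (prodPMF fun _ => p) fun s =>
    prodPMF fun i => W (c.enc₁ (fun k => (s k).1) i, c.enc₂ (fun k => (s k).2) i)

/-- The average distortion `(1/n) ∑ᵢ E[d₁(S₁ᵢ, Ŝ₁ᵢ)]`. -/
def Code.distortion₁ (c : Code S₁ S₂ X₁ X₂ Y T₁ T₂ n) (p : PMF (S₁ × S₂)) (W : X₁ × X₂ → PMF Y)
    (d₁ : S₁ → T₁ → ℝ) : ℝ :=
  (1 / (n : ℝ)) * ∑ i, expect (c.law p W) fun ω => d₁ (ω.1 i).1 (c.dec₁ ω.2 i)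

/-- The average distortion `(1/n) ∑ᵢ E[d₂(S₂ᵢ, Ŝ₂ᵢ)]`. -/
def Code.distortion₂ (c : Code S₁ S₂ X₁ X₂ Y T₁ T₂ n) (p : PMF (S₁ × S₂)) (W : X₁ × X₂ → PMF Y)
    (d₂ : S₂ → T₂ → ℝ) : ℝ :=
  (1 / (n : ℝ)) * ∑ i, expect (c.law p W) fun ω => d₂ (ω.1 i).2 (c.dec₂ ω.2 i)

/-- `(D₁, D₂)` is achievable: for every `ε > 0` and all large `n` some code of length `n` has
average distortions at most `D₁ + ε` and `D₂ + ε`. -/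
def Achievable (p : PMF (S₁ × S₂)) (W : X₁ × X₂ → PMF Y) (d₁ : S₁ → T₁ → ℝ) (d₂ : S₂ → T₂ → ℝ)
    (D₁ D₂ : ℝ) : Prop :=
  ∀ ε : ℝ, 0 < ε → ∃ N : ℕ, ∀ n : ℕ, N ≤ n → ∃ c : Code S₁ S₂ X₁ X₂ Y T₁ T₂ n,
    c.distortion₁ p W d₁ ≤ D₁ + ε ∧ c.distortion₂ p W d₂ ≤ D₂ + ε

end

end MAC

end

noncomputable section

namespace MAC

open scoped BigOperators Classical
open Real Finset Filter Topology

/-! ### Finite mass functions -/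

/-- The push-forward of a mass function `μ` under `X`. -/
def marg {Ω A : Type*} [Fintype Ω] (μ : Ω → ℝ) (X : Ω → A) (a : A) : ℝ :=
  ∑ ω, if X ω = a then μ ω else 0

/-- The entropy of `X` under the mass function `μ`. -/
def ent {Ω A : Type*} [Fintype Ω] [Fintype A] (μ : Ω → ℝ) (X : Ω → A) : ℝ :=
  ∑ a, negMulLog (marg μ X a)

/-- The conditional mutual information `I(X; Y | Z)` under the mass function `μ`. -/
def cmi {Ω A B C : Type*} [Fintype Ω] [Fintype A] [Fintype B] [Fintype C] (μ : Ω → ℝ)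
    (X : Ω → A) (Y : Ω → B) (Z : Ω → C) : ℝ :=
  ent μ (fun ω => (X ω, Z ω)) + ent μ (fun ω => (Y ω, Z ω))
    - ent μ (fun ω => (X ω, Y ω, Z ω)) - ent μ Z

/-- The mutual information of a possibly unnormalised joint mass function. -/
def massInfo {A B : Type*} [Fintype A] [Fintype B] (f : A → B → ℝ) : ℝ :=
  ∑ a, negMulLog (∑ b, f a b) + ∑ b, negMulLog (∑ a, f a b)
    - ∑ a, ∑ b, negMulLog (f a b) - negMulLog (∑ a, ∑ b, f a b)

section Marg

variable {Ω A B C : Type*} [Fintype Ω]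

lemma marg_nonneg {μ : Ω → ℝ} (hμ : ∀ ω, 0 ≤ μ ω) (X : Ω → A) (a : A) : 0 ≤ marg μ X a :=
  Finset.sum_nonneg fun ω _ => by split_ifs <;> simp [hμ]

lemma sum_marg_mul [Fintype A] (μ : Ω → ℝ) (X : Ω → A) (g : A → ℝ) :
    ∑ a, marg μ X a * g a = ∑ ω, μ ω * g (X ω) := by
  simp only [marg, Finset.sum_mul, ite_mul, zero_mul]
  rw [Finset.sum_comm]
  simp

lemma sum_marg [Fintype A] (μ : Ω → ℝ) (X : Ω → A) : ∑ a, marg μ X a = ∑ ω, μ ω := by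
  simpa using sum_marg_mul μ X fun _ => 1

lemma marg_marg [Fintype A] (μ : Ω → ℝ) (X : Ω → A) (f : A → B) (b : B) :
    marg (marg μ X) f b = marg μ (fun ω => f (X ω)) b := by
  have := sum_marg_mul μ X fun a => if f a = b then 1 else 0
  simpa [marg] using this

lemma sum_marg_prodMk_right [Fintype B] (μ : Ω → ℝ) (X : Ω → A) (Y : Ω → B) (a : A) :
    ∑ b, marg μ (fun ω => (X ω, Y ω)) (a, b) = marg μ X a := by
  simp only [marg, Prod.mk.injEq]
  rw [Finset.sum_comm]
  refine Finset.sum_congr rfl fun ω _ => ?_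
  by_cases h : X ω = a <;> simp [h]

lemma sum_marg_prodMk_left [Fintype A] (μ : Ω → ℝ) (X : Ω → A) (Y : Ω → B) (b : B) :
    ∑ a, marg μ (fun ω => (X ω, Y ω)) (a, b) = marg μ Y b := by
  simp only [marg, Prod.mk.injEq]
  rw [Finset.sum_comm]
  refine Finset.sum_congr rfl fun ω _ => ?_
  by_cases h : Y ω = b <;> simp [h]

lemma sum_marg_triple_mid [Fintype B] (μ : Ω → ℝ) (X : Ω → A) (Y : Ω → B) (Z : Ω → C) (a : A) (c : C) :
    ∑ b, marg μ (fun ω => (X ω, Y ω, Z ω)) (a, b, c) = marg μ (fun ω => (X ω, Z ω)) (a, c) := by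
  simp only [marg, Prod.mk.injEq]
  rw [Finset.sum_comm]
  refine Finset.sum_congr rfl fun ω _ => ?_
  by_cases h : X ω = a <;> by_cases h' : Z ω = c <;> simp [h, h']

lemma ent_eq_sum [Fintype A] (μ : Ω → ℝ) (X : Ω → A) :
    ent μ X = ∑ ω, μ ω * -log (marg μ X (X ω)) := by
  rw [← sum_marg_mul μ X fun a => -log (marg μ X a)]
  exact Finset.sum_congr rfl fun a _ => by rw [negMulLog]; ring

lemma ent_congr [Fintype A] [Fintype B] (μ : Ω → ℝ) {X : Ω → A} {X' : Ω → B}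
    (h : ∀ ω ω', X ω = X ω' ↔ X' ω = X' ω') : ent μ X = ent μ X' := by
  simp only [ent_eq_sum, marg, h]

end Marg

section MassInfo

variable {A B : Type*} [Fintype A] [Fintype B]

lemma massInfo_eq {f : A → B → ℝ} (hf : ∀ a b, 0 ≤ f a b) :
    massInfo f = ∑ a, ∑ b, f a b *
      log (f a b * (∑ a, ∑ b, f a b) / ((∑ b, f a b) * ∑ a, f a b)) := by
  have key : ∀ a b, f a b * log (f a b * (∑ a, ∑ b, f a b) / ((∑ b, f a b) * ∑ a, f a b)) =
      f a b * log (f a b) + f a b * log (∑ a, ∑ b, f a b) - f a b * log (∑ b, f a b)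
        - f a b * log (∑ a, f a b) := by
    intro a b
    rcases (hf a b).eq_or_lt with h | h
    · simp [← h]
    · have h1 : 0 < ∑ b, f a b :=
        h.trans_le (Finset.single_le_sum (fun b _ => hf a b) (Finset.mem_univ b))
      have h2 : 0 < ∑ a, f a b :=
        h.trans_le (Finset.single_le_sum (f := fun a => f a b) (fun a _ => hf a b)
          (Finset.mem_univ a))
      have h3 : 0 < ∑ a, ∑ b, f a b :=
        h1.trans_le (Finset.single_le_sum (f := fun a => ∑ b, f a b)
          (fun a _ => Finset.sum_nonneg fun b _ => hf a b) (Finset.mem_univ a))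
      rw [log_div (by positivity) (by positivity), log_mul h.ne' h3.ne', log_mul h1.ne' h2.ne']
      ring
  simp only [key, Finset.sum_sub_distrib, Finset.sum_add_distrib, ← Finset.sum_mul]
  rw [Finset.sum_comm (f := fun a b => f a b * log (∑ a, f a b))]
  simp only [← Finset.sum_mul, massInfo, negMulLog, neg_mul, Finset.sum_neg_distrib]
  ring

lemma massInfo_nonneg {f : A → B → ℝ} (hf : ∀ a b, 0 ≤ f a b) : 0 ≤ massInfo f := by
  rw [massInfo_eq hf]
  set F := ∑ a, ∑ b, f a b with hF
  have hF0 : 0 ≤ F := Finset.sum_nonneg fun a _ => Finset.sum_nonneg fun b _ => hf a b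
  rcases hF0.eq_or_lt with h0 | hFpos
  · simp [← h0]
  have hcomm : ∑ b, ∑ a, f a b = F := by rw [hF, Finset.sum_comm]
  have key : ∀ a b, f a b - (∑ b, f a b) * (∑ a, f a b) / F ≤
      f a b * log (f a b * F / ((∑ b, f a b) * ∑ a, f a b)) := by
    intro a b
    have h1' : 0 ≤ ∑ b, f a b := Finset.sum_nonneg fun b _ => hf a b
    have h2' : 0 ≤ ∑ a, f a b := Finset.sum_nonneg fun a _ => hf a b
    rcases (hf a b).eq_or_lt with h | h
    · rw [← h]; simp; positivity
    · have h1 : 0 < ∑ b, f a b :=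
        h.trans_le (Finset.single_le_sum (fun b _ => hf a b) (Finset.mem_univ b))
      have h2 : 0 < ∑ a, f a b :=
        h.trans_le (Finset.single_le_sum (f := fun a => f a b) (fun a _ => hf a b)
          (Finset.mem_univ a))
      have := one_sub_inv_le_log_of_pos
        (show 0 < f a b * F / ((∑ b, f a b) * ∑ a, f a b) by positivity)
      refine le_trans (le_of_eq ?_) (mul_le_mul_of_nonneg_left this h.le)
      field_simp
  calc (0 : ℝ) = ∑ a, ∑ b, (f a b - (∑ b, f a b) * (∑ a, f a b) / F) := by
        simp only [Finset.sum_sub_distrib, ← Finset.sum_div, ← Finset.mul_sum, ← Finset.sum_mul,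
          hcomm, ← hF]
        field_simp
        ring
    _ ≤ _ := Finset.sum_le_sum fun a _ => Finset.sum_le_sum fun b _ => key a b

lemma massInfo_eq_zero {f : A → B → ℝ} (hf : ∀ a b, 0 ≤ f a b)
    (h : ∀ a b, f a b * (∑ a, ∑ b, f a b) = (∑ b, f a b) * ∑ a, f a b) : massInfo f = 0 := by
  rw [massInfo_eq hf]
  refine Finset.sum_eq_zero fun a _ => Finset.sum_eq_zero fun b _ => ?_
  rw [h]
  by_cases h0 : (∑ b, f a b) * ∑ a, f a b = 0
  · simp [h0]
  · simp [div_self h0]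

lemma massInfo_const_mul (c : ℝ) (f : A → B → ℝ) :
    massInfo (fun a b => c * f a b) = c * massInfo f := by
  simp only [massInfo, ← Finset.mul_sum, negMulLog_mul, Finset.sum_add_distrib, ← Finset.sum_mul]
  rw [Finset.sum_comm (f := fun b a => f a b)]
  ring

lemma continuous_massInfo : Continuous (massInfo : (A → B → ℝ) → ℝ) := by
  unfold massInfo
  have := continuous_negMulLog
  fun_prop

end MassInfo

section Cmi

variable {Ω A B C E : Type*} [Fintype Ω] [Fintype A] [Fintype B] [Fintype C] [Fintype E]

lemma cmi_eq_sum (μ : Ω → ℝ) (X : Ω → A) (Y : Ω → B) (Z : Ω → C) :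
    cmi μ X Y Z = ∑ c, massInfo fun a b => marg μ (fun ω => (X ω, Y ω, Z ω)) (a, b, c) := by
  have h1 : ∀ b c, ∑ a, marg μ (fun ω => (X ω, Y ω, Z ω)) (a, b, c) =
      marg μ (fun ω => (Y ω, Z ω)) (b, c) := fun b c =>
    sum_marg_prodMk_left μ X (fun ω => (Y ω, Z ω)) (b, c)
  simp only [massInfo, sum_marg_triple_mid, h1, sum_marg_prodMk_left, Finset.sum_sub_distrib,
    Finset.sum_add_distrib, cmi, ent, Fintype.sum_prod_type_right]
  congr 2
  refine Finset.sum_congr rfl fun c _ => ?_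
  rw [Finset.sum_comm]

lemma cmi_nonneg {μ : Ω → ℝ} (hμ : ∀ ω, 0 ≤ μ ω) (X : Ω → A) (Y : Ω → B) (Z : Ω → C) :
    0 ≤ cmi μ X Y Z := by
  rw [cmi_eq_sum]
  exact Finset.sum_nonneg fun c _ => massInfo_nonneg fun a b => marg_nonneg hμ _ _

/-- Conditional independence of `X` and `Y` given `Z` under the mass function `μ`. -/
def CondIndep (μ : Ω → ℝ) (X : Ω → A) (Y : Ω → B) (Z : Ω → C) : Prop :=
  ∀ a b c, marg μ (fun ω => (X ω, Y ω, Z ω)) (a, b, c) * marg μ Z c =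
    marg μ (fun ω => (X ω, Z ω)) (a, c) * marg μ (fun ω => (Y ω, Z ω)) (b, c)

lemma cmi_eq_zero {μ : Ω → ℝ} (hμ : ∀ ω, 0 ≤ μ ω) {X : Ω → A} {Y : Ω → B} {Z : Ω → C}
    (h : CondIndep μ X Y Z) : cmi μ X Y Z = 0 := by
  rw [cmi_eq_sum]
  refine Finset.sum_eq_zero fun c _ => massInfo_eq_zero (fun a b => marg_nonneg hμ _ _) ?_
  intro a b
  have h1 : ∀ b c, ∑ a, marg μ (fun ω => (X ω, Y ω, Z ω)) (a, b, c) =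
      marg μ (fun ω => (Y ω, Z ω)) (b, c) := fun b c =>
    sum_marg_prodMk_left μ X (fun ω => (Y ω, Z ω)) (b, c)
  simp only [sum_marg_triple_mid, h1, sum_marg_prodMk_left]
  exact h a b c

/-- Conditioning on more reduces entropy. -/
lemma condEnt_anti {μ : Ω → ℝ} (hμ : ∀ ω, 0 ≤ μ ω) (X : Ω → A) {Y : Ω → B} {Z : Ω → C}
    (h : ∀ ω ω', Z ω = Z ω' → Y ω = Y ω') :
    ent μ (fun ω => (X ω, Z ω)) - ent μ Z ≤ ent μ (fun ω => (X ω, Y ω)) - ent μ Y := by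
  have := cmi_nonneg hμ X Z Y
  rw [cmi, ent_congr μ (X := fun ω => (Z ω, Y ω)) (X' := Z) (by grind),
    ent_congr μ (X := fun ω => (X ω, Z ω, Y ω)) (X' := fun ω => (X ω, Z ω)) (by grind)] at this
  linarith

/-- Conditional entropy is subadditive. -/
lemma condEnt_pi_le {μ : Ω → ℝ} (hμ : ∀ ω, 0 ≤ μ ω) (Z : Ω → C) :
    ∀ {n : ℕ} (V : Fin n → Ω → B), ent μ (fun ω => ((fun i => V i ω), Z ω)) - ent μ Z ≤
      ∑ i, (ent μ (fun ω => (V i ω, Z ω)) - ent μ Z)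
  | 0, V => by
    rw [ent_congr μ (X := fun ω => ((fun i => V i ω), Z ω)) (X' := Z)
      (by simp [funext_iff])]
    simp
  | n + 1, V => by
    have ih := condEnt_pi_le hμ Z fun i : Fin n => V i.succ
    have h := cmi_nonneg hμ (V 0) (fun ω => fun i : Fin n => V i.succ ω) Z
    rw [cmi, ent_congr μ (X := fun ω => (V 0 ω, (fun i : Fin n => V i.succ ω), Z ω))
      (X' := fun ω => ((fun i => V i ω), Z ω))
      (by simp [funext_iff, Fin.forall_fin_succ, and_assoc])] at h
    rw [Fin.sum_univ_succ]
    linarith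

lemma CondIndep.comp {μ : Ω → ℝ} {X : Ω → A} {Y : Ω → B} {Z : Ω → C} (h : CondIndep μ X Y Z)
    {A' B' : Type*} (f : A → A') (g : B → B') (a' : A') (b' : B') (c : C) :
    marg μ (fun ω => (f (X ω), g (Y ω), Z ω)) (a', b', c) * marg μ Z c =
      marg μ (fun ω => (f (X ω), Z ω)) (a', c) * marg μ (fun ω => (g (Y ω), Z ω)) (b', c) := by
  have h1 : marg μ (fun ω => (f (X ω), g (Y ω), Z ω)) (a', b', c) =
      ∑ a, ∑ b, if f a = a' ∧ g b = b' then
        marg μ (fun ω => (X ω, Y ω, Z ω)) (a, b, c) else 0 := by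
    rw [← marg_marg μ (fun ω => (X ω, Y ω, Z ω)) (fun t => (f t.1, g t.2.1, t.2.2))]
    simp only [marg.eq_1 (marg μ _), Fintype.sum_prod_type, Prod.mk.injEq]
    refine Finset.sum_congr rfl fun a _ => Finset.sum_congr rfl fun b _ => ?_
    by_cases h1 : f a = a' <;> by_cases h2 : g b = b' <;> simp [h1, h2]
  have h2 : marg μ (fun ω => (f (X ω), Z ω)) (a', c) =
      ∑ a, if f a = a' then marg μ (fun ω => (X ω, Z ω)) (a, c) else 0 := by
    rw [← marg_marg μ (fun ω => (X ω, Z ω)) (fun t => (f t.1, t.2))]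
    simp only [marg.eq_1 (marg μ _), Fintype.sum_prod_type, Prod.mk.injEq]
    refine Finset.sum_congr rfl fun a _ => ?_
    by_cases h1 : f a = a' <;> simp [h1]
  have h3 : marg μ (fun ω => (g (Y ω), Z ω)) (b', c) =
      ∑ b, if g b = b' then marg μ (fun ω => (Y ω, Z ω)) (b, c) else 0 := by
    rw [← marg_marg μ (fun ω => (Y ω, Z ω)) (fun t => (g t.1, t.2))]
    simp only [marg.eq_1 (marg μ _), Fintype.sum_prod_type, Prod.mk.injEq]
    refine Finset.sum_congr rfl fun a _ => ?_
    by_cases h1 : g a = b' <;> simp [h1]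
  rw [h1, h2, h3, Finset.sum_mul_sum, Finset.sum_mul]
  refine Finset.sum_congr rfl fun a _ => ?_
  rw [Finset.sum_mul]
  refine Finset.sum_congr rfl fun b _ => ?_
  by_cases h1 : f a = a' <;> by_cases h2 : g b = b' <;> simp [h1, h2, h a b c]

/-- Mutual information is convex in the channel, for a fixed input law `g`. -/
lemma massInfo_sum_le {ι : Type*} [Fintype ι] {w : ι → ℝ} (hw : ∀ i, 0 ≤ w i)
    (hw1 : ∑ i, w i = 1) {f : ι → A → B → ℝ} (hf : ∀ i a b, 0 ≤ f i a b) {g : A → ℝ}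
    (hg : ∀ i a, ∑ b, f i a b = g a) :
    massInfo (fun a b => ∑ i, w i * f i a b) ≤ ∑ i, w i * massInfo (f i) := by
  let μ : ι × A × B → ℝ := fun t => w t.1 * f t.1 t.2.1 t.2.2
  have hμ : ∀ ω, 0 ≤ μ ω := fun t => mul_nonneg (hw _) (hf _ _ _)
  let I : ι × A × B → ι := fun t => t.1
  let X : ι × A × B → A := fun t => t.2.1
  let Y : ι × A × B → B := fun t => t.2.2
  have e1 : massInfo (fun a b => ∑ i, w i * f i a b) = cmi μ X Y (fun _ => ()) := by
    rw [cmi_eq_sum]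
    simp [marg, Fintype.sum_prod_type, μ, X, Y, ite_and]
  have e2 : ∑ i, w i * massInfo (f i) = cmi μ X Y I := by
    rw [cmi_eq_sum]
    refine Finset.sum_congr rfl fun i _ => ?_
    rw [← massInfo_const_mul]
    simp [marg, Fintype.sum_prod_type, μ, X, Y, I, ite_and]
  have e3 : cmi μ X I (fun _ => ()) = 0 := by
    refine cmi_eq_zero hμ ?_
    intro a i _
    have h1 : marg μ (fun ω => (X ω, I ω, ())) (a, i, ()) = w i * g a := by
      simp [marg, Fintype.sum_prod_type, μ, X, I, ite_and, ← Finset.mul_sum, hg]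
    have h2 : marg μ (fun ω => (X ω, ())) (a, ()) = g a := by
      simp [marg, Fintype.sum_prod_type, μ, X, ← Finset.mul_sum, hg, ← Finset.sum_mul, hw1]
    have h3 : marg μ (fun ω => (I ω, ())) (i, ()) = w i * ∑ a, g a := by
      simp [marg, Fintype.sum_prod_type, μ, I, ← Finset.mul_sum, hg]
    have h4 : marg μ (fun _ => ()) () = ∑ a, g a := by
      simp [marg, Fintype.sum_prod_type, μ, ← Finset.mul_sum, hg, ← Finset.sum_mul, hw1]
    change marg μ (fun ω => (X ω, I ω, ())) (a, i, ()) * marg μ (fun _ => ()) () =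
      marg μ (fun ω => (X ω, ())) (a, ()) * marg μ (fun ω => (I ω, ())) (i, ())
    rw [h1, h2, h3, h4]; ring
  have e4 := cmi_nonneg hμ X I Y
  rw [e1, e2]
  simp only [cmi] at e3 e4 ⊢
  rw [ent_congr μ (X := fun ω => (X ω, Y ω)) (X' := fun ω => (X ω, Y ω, ())) (by simp),
    ent_congr μ (X := fun ω => (X ω, I ω, Y ω)) (X' := fun ω => (X ω, Y ω, I ω)) (by grind),
    ent_congr μ (X := fun ω => (I ω, Y ω)) (X' := fun ω => (Y ω, I ω)) (by grind),
    ent_congr μ (X := Y) (X' := fun ω => (Y ω, ())) (by simp)] at e4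
  rw [ent_congr μ (X := fun ω => (I ω, ())) (X' := I) (by simp),
    ent_congr μ (X := fun ω => (X ω, I ω, ())) (X' := fun ω => (X ω, I ω)) (by simp)] at e3
  linarith

/-- The information transmitted over a stochastic matrix `w`. -/
lemma massInfo_channel {m : A → ℝ} {w : A → B → ℝ} (hw : ∀ a, ∑ b, w a b = 1) :
    massInfo (fun a b => m a * w a b) =
      ∑ b, negMulLog (∑ a, m a * w a b) - ∑ a, m a * ∑ b, negMulLog (w a b)
        - negMulLog (∑ a, m a) := by
  simp only [massInfo, ← Finset.mul_sum, hw, mul_one, negMulLog_mul, Finset.sum_add_distrib,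
    ← Finset.sum_mul, one_mul]
  ring

/-- Mutual information is concave in the input law. -/
lemma sum_massInfo_le {ι : Type*} [Fintype ι] {v : ι → ℝ} (hv : ∀ i, 0 ≤ v i)
    (hv1 : ∑ i, v i = 1) {m : ι → A → ℝ} (hm : ∀ i a, 0 ≤ m i a) (hm1 : ∀ i, ∑ a, m i a = 1)
    {w : A → B → ℝ} (hw0 : ∀ a b, 0 ≤ w a b) (hw : ∀ a, ∑ b, w a b = 1) :
    ∑ i, v i * massInfo (fun a b => m i a * w a b) ≤
      massInfo (fun a b => (∑ i, v i * m i a) * w a b) := by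
  have htot : ∑ a, ∑ i, v i * m i a = 1 := by
    rw [Finset.sum_comm]; simp [← Finset.mul_sum, hm1, hv1]
  simp only [massInfo_channel hw, hm1, htot, negMulLog_one, sub_zero, mul_sub,
    Finset.sum_sub_distrib]
  have e1 : ∑ i, v i * ∑ a, m i a * ∑ b, negMulLog (w a b) =
      ∑ a, (∑ i, v i * m i a) * ∑ b, negMulLog (w a b) := by
    simp only [Finset.mul_sum (s := (univ : Finset A)), Finset.sum_mul]
    rw [Finset.sum_comm]
    exact Finset.sum_congr rfl fun a _ => Finset.sum_congr rfl fun i _ => by ring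
  rw [e1]
  refine sub_le_sub_right ?_ _
  simp only [Finset.mul_sum (s := (univ : Finset B))]
  rw [Finset.sum_comm]
  refine Finset.sum_le_sum fun b _ => ?_
  have := concaveOn_negMulLog.le_map_sum (t := univ) (w := v)
    (p := fun i => ∑ a, m i a * w a b) (fun i _ => hv i) hv1
    (fun i _ => Finset.sum_nonneg fun a _ => mul_nonneg (hm i a) (hw0 a b))
  simp only [smul_eq_mul] at this
  refine this.trans (le_of_eq ?_)
  congr 1
  simp only [Finset.mul_sum, Finset.sum_mul]
  rw [Finset.sum_comm]
  exact Finset.sum_congr rfl fun a _ => Finset.sum_congr rfl fun i _ => by ring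

end Cmi

/-! ### Product laws -/

section Product

variable {B : Type*} [Fintype B] {n : ℕ}

lemma sum_pi_prod_mul (q : Fin n → B → ℝ) (hq : ∀ i, ∑ b, q i b = 1) (i : Fin n) (g : B → ℝ) :
    ∑ b : Fin n → B, (∏ j, q j (b j)) * g (b i) = ∑ b, q i b * g b := by
  have h1 : ∀ b : Fin n → B, (∏ j, q j (b j)) * g (b i) =
      ∏ j, q j (b j) * if j = i then g (b j) else 1 := by
    intro b
    rw [Finset.prod_mul_distrib]
    simp
  simp only [h1]
  rw [← Fintype.prod_sum (fun j b => q j b * if j = i then g b else 1),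
    Finset.prod_eq_single i]
  · simp
  · intro j _ hj
    simp [hj, hq]
  · simp

lemma sum_pi_prod (q : Fin n → B → ℝ) (hq : ∀ i, ∑ b, q i b = 1) :
    ∑ b : Fin n → B, ∏ j, q j (b j) = 1 := by
  rw [← Fintype.prod_sum (fun j b => q j b)]
  simp [hq]

lemma sum_negMulLog_prod (q : Fin n → B → ℝ) (hq : ∀ i, ∑ b, q i b = 1) :
    ∑ b : Fin n → B, negMulLog (∏ j, q j (b j)) = ∑ i, ∑ b, negMulLog (q i b) := by
  have h1 : ∀ b : Fin n → B, negMulLog (∏ j, q j (b j)) =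
      ∑ i, (∏ j, q j (b j)) * -log (q i (b i)) := by
    intro b
    rw [← Finset.mul_sum, Finset.sum_neg_distrib]
    by_cases h : ∏ j, q j (b j) = 0
    · simp [h]
    · rw [negMulLog, log_prod (fun i hi => by
        have := Finset.prod_ne_zero_iff.1 h i hi
        exact this)]
      ring
  simp only [h1]
  rw [Finset.sum_comm]
  refine Finset.sum_congr rfl fun i _ => ?_
  rw [sum_pi_prod_mul q hq i fun b => -log (q i b)]
  exact Finset.sum_congr rfl fun b _ => by rw [negMulLog]; ring

end Product

/-! ### The law of a source block and of the channel output block -/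

/-- The joint mass function of an i.i.d. source block with letter law `r` and of the output of the
memoryless channel `w`, whose `i`-th input is the function `x i` of the source block. -/
def blockMass {A X Y : Type*} {n : ℕ} (r : A → ℝ) (w : X → Y → ℝ) (x : Fin n → (Fin n → A) → X) :
    (Fin n → A) × (Fin n → Y) → ℝ :=
  fun t => (∏ i, r (t.1 i)) * ∏ i, w (x i t.1) (t.2 i)

section Block

variable {A X Y : Type*} {n : ℕ} {r : A → ℝ} {w : X → Y → ℝ} {x : Fin n → (Fin n → A) → X}

lemma blockMass_nonneg (hr : ∀ a, 0 ≤ r a) (hw : ∀ a y, 0 ≤ w a y) (t) :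
    0 ≤ blockMass r w x t :=
  mul_nonneg (Finset.prod_nonneg fun _ _ => hr _) (Finset.prod_nonneg fun _ _ => hw _ _)

variable [Fintype A] [Fintype Y]

lemma sum_blockMass_source (hw : ∀ a, ∑ y, w a y = 1) (g : (Fin n → A) → ℝ) :
    ∑ t, blockMass r w x t * g t.1 = ∑ s : Fin n → A, (∏ i, r (s i)) * g s := by
  simp only [blockMass, Fintype.sum_prod_type]
  refine Finset.sum_congr rfl fun s _ => ?_
  rw [← Finset.sum_mul, ← Finset.mul_sum, sum_pi_prod _ fun i => hw (x i s), mul_one]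

lemma sum_blockMass_output (hw : ∀ a, ∑ y, w a y = 1) (i : Fin n) (g : (Fin n → A) → Y → ℝ) :
    ∑ t, blockMass r w x t * g t.1 (t.2 i) =
      ∑ s : Fin n → A, (∏ j, r (s j)) * ∑ y, w (x i s) y * g s y := by
  simp only [blockMass, Fintype.sum_prod_type, mul_assoc, ← Finset.mul_sum]
  refine Finset.sum_congr rfl fun s _ => ?_
  rw [sum_pi_prod_mul (fun j => w (x j s)) (fun i => hw _) i (g s)]

lemma marg_blockMass_source {B : Type*} (hw : ∀ a, ∑ y, w a y = 1) (D : (Fin n → A) → B) (b : B) :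
    marg (blockMass r w x) (fun t => D t.1) b =
      ∑ s : Fin n → A, (∏ i, r (s i)) * if D s = b then 1 else 0 := by
  rw [← sum_blockMass_source (x := x) hw]
  simp [marg]

lemma marg_blockMass_pi {B C : Type*} (hw : ∀ a, ∑ y, w a y = 1) {D : (Fin n → A) → B} {b : B}
    {φ : A → C} {v : Fin n → C} (h : ∀ s, D s = b ↔ ∀ j, φ (s j) = v j) :
    marg (blockMass r w x) (fun t => D t.1) b = ∏ j, marg r φ (v j) := by
  rw [marg_blockMass_source hw]
  simp only [marg]
  rw [Fintype.prod_sum (fun j a => if φ a = v j then r a else 0)]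
  refine Finset.sum_congr rfl fun s _ => ?_
  by_cases hs : D s = b
  · simp [(h s).1 hs, hs]
  · have : ∃ j, φ (s j) ≠ v j := by
      by_contra hc
      push Not at hc
      exact hs ((h s).2 hc)
    obtain ⟨j, hj⟩ := this
    refine Eq.trans ?_ (Finset.prod_eq_zero (Finset.mem_univ j) (if_neg hj)).symm
    simp [hs]

lemma marg_blockMass_letter {B : Type*} (hr1 : ∑ a, r a = 1) (hw : ∀ a, ∑ y, w a y = 1)
    (φ : A → B) (i : Fin n) (b : B) :
    marg (blockMass r w x) (fun t => φ (t.1 i)) b = marg r φ b := by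
  rw [marg_blockMass_source hw (fun s => φ (s i)),
    sum_pi_prod_mul (fun _ => r) (fun _ => hr1) i fun a => if φ a = b then 1 else 0]
  simp [marg]

lemma ent_blockMass_pi {B : Type*} [Fintype B] (hr1 : ∑ a, r a = 1) (hw : ∀ a, ∑ y, w a y = 1)
    (φ : A → B) :
    ent (blockMass r w x) (fun t j => φ (t.1 j)) =
      ∑ i, ent (blockMass r w x) (fun t => φ (t.1 i)) := by
  have h1 : ∀ b : Fin n → B, marg (blockMass r w x) (fun t j => φ (t.1 j)) b =
      ∏ j, marg r φ (b j) := fun b =>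
    marg_blockMass_pi hw (D := fun s j => φ (s j)) (fun s => by simp [funext_iff])
  simp only [ent, h1, marg_blockMass_letter hr1 hw]
  exact sum_negMulLog_prod (fun _ => marg r φ) fun _ => by rw [sum_marg, hr1]

/-- The rate needed for single-letter reconstructions is at most the block information. -/
lemma sum_cmi_letter_le {B C T : Type*} [Fintype B] [Fintype C] [Fintype T] (hr : ∀ a, 0 ≤ r a)
    (hr1 : ∑ a, r a = 1) (hw0 : ∀ a y, 0 ≤ w a y) (hw : ∀ a, ∑ y, w a y = 1) (f : A → B)
    (k : A → C) (τ : Fin n → (Fin n → Y) → T) :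
    ∑ i, cmi (blockMass r w x) (fun t => f (t.1 i)) (fun t => τ i t.2) (fun t => k (t.1 i)) ≤
      cmi (blockMass r w x) (fun t j => f (t.1 j)) (fun t => t.2) (fun t j => k (t.1 j)) := by
  set μ := blockMass r w x with hμdef
  have hμ : ∀ t, 0 ≤ μ t := blockMass_nonneg hr hw0
  have e1 : ent μ (fun t => ((fun j => f (t.1 j)), fun j => k (t.1 j))) =
      ∑ i, ent μ (fun t => (f (t.1 i), k (t.1 i))) := by
    rw [← ent_blockMass_pi hr1 hw fun a => (f a, k a)]
    exact ent_congr _ (by simp [funext_iff, forall_and])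
  have e2 : ent μ (fun t j => k (t.1 j)) = ∑ i, ent μ (fun t => k (t.1 i)) :=
    ent_blockMass_pi hr1 hw k
  have e3 := condEnt_pi_le hμ (fun t => (t.2, fun j => k (t.1 j))) fun i t => f (t.1 i)
  have e4 : ∀ i, ent μ (fun t => (f (t.1 i), t.2, fun j => k (t.1 j))) -
        ent μ (fun t => (t.2, fun j => k (t.1 j))) ≤
      ent μ (fun t => (f (t.1 i), τ i t.2, k (t.1 i))) - ent μ (fun t => (τ i t.2, k (t.1 i))) := by
    intro i
    refine condEnt_anti hμ (fun t => f (t.1 i)) ?_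
    intro t t' h
    simp only [Prod.mk.injEq, funext_iff] at h ⊢
    exact ⟨by rw [funext h.1], h.2 i⟩
  have e5 := e3.trans (Finset.sum_le_sum fun i _ => e4 i)
  simp only [cmi, Finset.sum_sub_distrib, Finset.sum_add_distrib] at e5 ⊢
  linarith

lemma marg_output {C : Type*} (hw : ∀ a, ∑ y, w a y = 1) (i : Fin n) {D : (Fin n → A) → C}
    {ξ : C → X} (hξ : ∀ s, x i s = ξ (D s)) (y : Y) (c : C) :
    marg (blockMass r w x) (fun t => (t.2 i, D t.1)) (y, c) =
      marg (blockMass r w x) (fun t => D t.1) c * w (ξ c) y := by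
  rw [marg_blockMass_source hw]
  have := sum_blockMass_output (r := r) (x := x) hw i
    fun s y' => if y' = y ∧ D s = c then 1 else 0
  simp only [mul_ite, mul_one, mul_zero] at this
  rw [marg]
  simp only [Prod.mk.injEq]
  rw [this, Finset.sum_mul]
  refine Finset.sum_congr rfl fun s _ => ?_
  by_cases hs : D s = c
  · simp [hs, hξ]
  · simp [hs]

/-- The entropy of a channel output letter given data that determines the channel input. -/
lemma condEnt_output {C : Type*} [Fintype C] (hr1 : ∑ a, r a = 1)
    (hw : ∀ a, ∑ y, w a y = 1) (i : Fin n) {D : (Fin n → A) → C}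
    (h : ∀ s s', D s = D s' → x i s = x i s') :
    ent (blockMass r w x) (fun t => (t.2 i, D t.1)) - ent (blockMass r w x) (fun t => D t.1) =
      ∑ s : Fin n → A, (∏ j, r (s j)) * ∑ y, negMulLog (w (x i s) y) := by
  have : Nonempty (Fin n → A) := by
    by_contra hc
    rw [not_nonempty_iff] at hc
    have : ∑ s : Fin n → A, ∏ j, r (s j) = 1 := sum_pi_prod (fun _ => r) fun _ => hr1
    simp at this
  obtain ⟨ξ, hξ⟩ : ∃ ξ : C → X, ∀ s, x i s = ξ (D s) := by
    refine ⟨fun c => x i (Function.invFun D c), fun s => h _ _ ?_⟩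
    exact (Function.invFun_eq ⟨s, rfl⟩).symm
  simp only [ent, Fintype.sum_prod_type_right, marg_output hw i hξ, negMulLog_mul, Finset.sum_add_distrib,
    ← Finset.sum_mul, ← Finset.mul_sum, hw, one_mul]
  rw [sum_marg_mul _ _ fun c => ∑ y, negMulLog (w (ξ c) y), add_sub_cancel_left,
    sum_blockMass_source hw fun s => ∑ y, negMulLog (w (ξ (D s)) y)]
  simp only [hξ]

/-- The entropy of the channel output block given the source block. -/
lemma condEnt_outputs (hw : ∀ a, ∑ y, w a y = 1) :
    ent (blockMass r w x) (fun t => (t.2, t.1)) - ent (blockMass r w x) (fun t => t.1) =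
      ∑ i, ∑ s : Fin n → A, (∏ j, r (s j)) * ∑ y, negMulLog (w (x i s) y) := by
  have h1 : ∀ s y, marg (blockMass r w x) (fun t => (t.2, t.1)) (y, s) =
      (∏ i, r (s i)) * ∏ i, w (x i s) (y i) := by
    intro s y
    rw [marg, Finset.sum_eq_single (s, y)]
    · simp [blockMass]
    · rintro ⟨s', y'⟩ _ hne
      rw [if_neg]
      rintro ⟨rfl, rfl⟩
      exact hne rfl
    · simp
  have h2 : ∀ s, marg (blockMass r w x) (fun t => t.1) s = ∏ i, r (s i) := by
    intro s
    rw [marg_blockMass_source hw (fun s => s)]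
    simp
  simp only [ent, Fintype.sum_prod_type_right, h1, h2, negMulLog_mul, Finset.sum_add_distrib,
    ← Finset.sum_mul, ← Finset.mul_sum]
  have h3 : ∀ s : Fin n → A, ∑ y : Fin n → Y, ∏ i, w (x i s) (y i) = 1 := fun s =>
    sum_pi_prod (fun i => w (x i s)) fun i => hw _
  have h4 : ∀ s : Fin n → A, ∑ y : Fin n → Y, negMulLog (∏ i, w (x i s) (y i)) =
      ∑ i, ∑ y, negMulLog (w (x i s) y) := fun s =>
    sum_negMulLog_prod (fun i => w (x i s)) fun i => hw _
  simp only [h3, h4, one_mul, add_sub_cancel_left]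
  simp only [Finset.mul_sum (s := (univ : Finset (Fin n)))]
  rw [Finset.sum_comm]

lemma cmi_output {B C : Type*} [Fintype B] [Fintype C] (hr1 : ∑ a, r a = 1)
    (hw : ∀ a, ∑ y, w a y = 1) (i : Fin n) {G : (Fin n → A) → B} {K : (Fin n → A) → C}
    (h : ∀ s s', G s = G s' → K s = K s' → x i s = x i s') :
    cmi (blockMass r w x) (fun t => G t.1) (fun t => t.2 i) (fun t => K t.1) =
      ent (blockMass r w x) (fun t => (t.2 i, K t.1)) - ent (blockMass r w x) (fun t => K t.1) -
        ∑ s : Fin n → A, (∏ j, r (s j)) * ∑ y, negMulLog (w (x i s) y) := by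
  rw [← condEnt_output hr1 hw i (D := fun s => (G s, K s)) (by grind), cmi,
    ent_congr _ (X := fun t : (Fin n → A) × (Fin n → Y) => (G t.1, t.2 i, K t.1))
      (X' := fun t => (t.2 i, G t.1, K t.1)) (by grind)]
  ring

lemma cmi_outputs_le {B C : Type*} [Fintype B] [Fintype C] (hr : ∀ a, 0 ≤ r a)
    (hw0 : ∀ a y, 0 ≤ w a y) (hw : ∀ a, ∑ y, w a y = 1) (F : (Fin n → A) → B)
    (K : (Fin n → A) → C) :
    cmi (blockMass r w x) (fun t => F t.1) (fun t => t.2) (fun t => K t.1) ≤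
      ∑ i, (ent (blockMass r w x) (fun t => (t.2 i, K t.1)) -
        ent (blockMass r w x) (fun t => K t.1) -
        ∑ s : Fin n → A, (∏ j, r (s j)) * ∑ y, negMulLog (w (x i s) y)) := by
  set μ := blockMass r w x
  have hμ : ∀ t, 0 ≤ μ t := blockMass_nonneg hr hw0
  have e1 := condEnt_pi_le hμ (fun t => K t.1) fun i t => t.2 i
  have e2 : ent μ (fun t => (t.2, t.1)) - ent μ (fun t => t.1) ≤
      ent μ (fun t => (t.2, F t.1, K t.1)) - ent μ (fun t => (F t.1, K t.1)) :=
    condEnt_anti hμ (fun t => t.2) (by grind)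
  rw [condEnt_outputs hw] at e2
  rw [Finset.sum_sub_distrib, cmi,
    ent_congr μ (X := fun t => (F t.1, t.2, K t.1)) (X' := fun t => (t.2, F t.1, K t.1))
      (by grind)]
  linarith

/-- Block information is at most the sum of the letter informations. -/
lemma cmi_le_sum_cmi_input [Fintype X] {B C : Type*} [Fintype B] [Fintype C] (hr : ∀ a, 0 ≤ r a)
    (hr1 : ∑ a, r a = 1) (hw0 : ∀ a y, 0 ≤ w a y) (hw : ∀ a, ∑ y, w a y = 1)
    (F : (Fin n → A) → B) (K : (Fin n → A) → C) :
    cmi (blockMass r w x) (fun t => F t.1) (fun t => t.2) (fun t => K t.1) ≤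
      ∑ i, cmi (blockMass r w x) (fun t => x i t.1) (fun t => t.2 i) (fun t => K t.1) := by
  refine (cmi_outputs_le hr hw0 hw F K).trans (Finset.sum_le_sum fun i _ => ?_)
  rw [cmi_output hr1 hw i (G := fun s => x i s) (by grind)]

lemma cmi_le_cmi_of_condIndep {Ω B C E G : Type*} [Fintype Ω] [Fintype B] [Fintype C] [Fintype E]
    [Fintype G] {μ : Ω → ℝ} (hμ : ∀ ω, 0 ≤ μ ω) {F : Ω → B} {H : Ω → G} {K : Ω → C}
    (h : CondIndep μ F H K) (Y : Ω → E) :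
    cmi μ F Y K ≤ cmi μ F Y (fun ω => (H ω, K ω)) := by
  have e1 := cmi_eq_zero hμ h
  have e2 := cmi_nonneg hμ F H (fun ω => (Y ω, K ω))
  simp only [cmi] at e1 e2 ⊢
  rw [ent_congr μ (X := fun ω => (F ω, H ω, Y ω, K ω)) (X' := fun ω => (F ω, Y ω, H ω, K ω))
      (by grind),
    ent_congr μ (X := fun ω => (H ω, Y ω, K ω)) (X' := fun ω => (Y ω, H ω, K ω)) (by grind)] at e2
  linarith

/-- The information about one of two conditionally independent sources. -/
lemma cmi_le_sum_cmi_of_condIndep {B C G X₁ X₂ : Type*} [Fintype B] [Fintype C] [Fintype G]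
    [Fintype X₁] [Fintype X₂] (hr : ∀ a, 0 ≤ r a) (hr1 : ∑ a, r a = 1) (hw0 : ∀ a y, 0 ≤ w a y)
    (hw : ∀ a, ∑ y, w a y = 1) {F : (Fin n → A) → B} {H : (Fin n → A) → G} {K : (Fin n → A) → C}
    (h : CondIndep (blockMass r w x) (fun t => F t.1) (fun t => H t.1) (fun t => K t.1))
    (x₁ : Fin n → (Fin n → A) → X₁) (x₂ : Fin n → G → X₂)
    (hx : ∀ i s s', x₁ i s = x₁ i s' → x₂ i (H s) = x₂ i (H s') → x i s = x i s') :
    cmi (blockMass r w x) (fun t => F t.1) (fun t => t.2) (fun t => K t.1) ≤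
      ∑ i, cmi (blockMass r w x) (fun t => x₁ i t.1) (fun t => t.2 i)
        (fun t => (x₂ i (H t.1), K t.1)) := by
  have hμ : ∀ t, 0 ≤ blockMass r w x t := blockMass_nonneg hr hw0
  refine (cmi_le_cmi_of_condIndep hμ h _).trans
    ((cmi_outputs_le hr hw0 hw F fun s => (H s, K s)).trans (Finset.sum_le_sum fun i _ => ?_))
  rw [cmi_output hr1 hw i (G := x₁ i) (K := fun s => (x₂ i (H s), K s)) (by grind)]
  refine sub_le_sub_right ?_ _
  exact condEnt_anti hμ (fun t => t.2 i) (by grind)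

/-- The sum of the informations about two conditionally independent sources. -/
lemma cmi_add_cmi_le_sum_cmi [Fintype X] {B C G : Type*} [Fintype B] [Fintype C] [Fintype G]
    (hr : ∀ a, 0 ≤ r a) (hr1 : ∑ a, r a = 1) (hw0 : ∀ a y, 0 ≤ w a y)
    (hw : ∀ a, ∑ y, w a y = 1) {F : (Fin n → A) → B} {H : (Fin n → A) → G} {K : (Fin n → A) → C}
    (h : CondIndep (blockMass r w x) (fun t => F t.1) (fun t => H t.1) (fun t => K t.1)) :
    cmi (blockMass r w x) (fun t => F t.1) (fun t => t.2) (fun t => K t.1) +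
      cmi (blockMass r w x) (fun t => H t.1) (fun t => t.2) (fun t => K t.1) ≤
      ∑ i, cmi (blockMass r w x) (fun t => x i t.1) (fun t => t.2 i) (fun t => K t.1) := by
  have hμ : ∀ t, 0 ≤ blockMass r w x t := blockMass_nonneg hr hw0
  have e1 := cmi_le_cmi_of_condIndep hμ h (fun t => t.2)
  have e2 := cmi_le_sum_cmi_input (x := x) hr hr1 hw0 hw (fun s => (F s, H s)) K
  refine le_trans ?_ e2
  simp only [cmi] at e1 ⊢
  rw [ent_congr (blockMass r w x) (X := fun t : (Fin n → A) × (Fin n → Y) => (t.2, H t.1, K t.1))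
      (X' := fun t => (H t.1, t.2, K t.1)) (by grind),
    ent_congr (blockMass r w x)
      (X := fun t : (Fin n → A) × (Fin n → Y) => (F t.1, t.2, H t.1, K t.1))
      (X' := fun t => ((F t.1, H t.1), t.2, K t.1)) (by grind),
    ent_congr (blockMass r w x)
      (X := fun t : (Fin n → A) × (Fin n → Y) => (F t.1, H t.1, K t.1))
      (X' := fun t => ((F t.1, H t.1), K t.1)) (by grind)] at e1
  linarith

lemma condIndep_blockMass {B C G : Type*} [Fintype B] [Fintype C] [Fintype G]
    (hw : ∀ a, ∑ y, w a y = 1) {f : A → B} {g : A → G} {k : A → C} (h : CondIndep r f g k) :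
    CondIndep (blockMass r w x) (fun t j => f (t.1 j)) (fun t j => g (t.1 j))
      (fun t j => k (t.1 j)) := by
  intro a b c
  rw [marg_blockMass_pi hw (D := fun s => ((fun j => f (s j)), (fun j => g (s j)),
      fun j => k (s j))) (φ := fun a => (f a, g a, k a)) (v := fun j => (a j, b j, c j))
      (by simp [funext_iff, forall_and]),
    marg_blockMass_pi hw (D := fun s j => k (s j)) (φ := k) (v := c) (by simp [funext_iff]),
    marg_blockMass_pi hw (D := fun s => ((fun j => f (s j)), fun j => k (s j)))
      (φ := fun a => (f a, k a)) (v := fun j => (a j, c j)) (by simp [funext_iff, forall_and]),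
    marg_blockMass_pi hw (D := fun s => ((fun j => g (s j)), fun j => k (s j)))
      (φ := fun a => (g a, k a)) (v := fun j => (b j, c j)) (by simp [funext_iff, forall_and]),
    ← Finset.prod_mul_distrib, ← Finset.prod_mul_distrib]
  exact Finset.prod_congr rfl fun j _ => h _ _ _

end Block

/-! ### The rate region of the channel -/

/-- In finite dimension the convex hull of a compact set is compact. -/
lemma isCompact_convexHull_of_isCompact {E : Type*} [NormedAddCommGroup E] [NormedSpace ℝ E]
    [FiniteDimensional ℝ E] {s : Set E} (hs : IsCompact s) : IsCompact (convexHull ℝ s) := by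
  let N := Module.finrank ℝ E + 1
  have hK : IsCompact ((fun q : (Fin N → ℝ) × (Fin N → E) => ∑ j, q.1 j • q.2 j) ''
      (stdSimplex ℝ (Fin N) ×ˢ Set.univ.pi fun _ => s)) :=
    ((isCompact_stdSimplex ℝ (Fin N)).prod (isCompact_univ_pi fun _ => hs)).image (by fun_prop)
  convert hK
  refine Set.Subset.antisymm ?_ ?_
  · intro x hx
    obtain ⟨ι, _, z, q, hz, hind, hq, hq1, rfl⟩ := eq_pos_convex_span_of_mem_convexHull hx
    obtain ⟨e⟩ : Nonempty (ι ↪ Fin N) := Function.Embedding.nonempty_of_card_le (by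
      simpa [N] using hind.card_le_finrank_succ.trans
        (Nat.succ_le_succ (Submodule.finrank_le _)))
    have hne : Nonempty ι := by
      by_contra hc
      rw [not_nonempty_iff] at hc
      simp at hq1
    have hout : ∀ j ∉ Set.range e, Function.extend e q 0 j = 0 := fun j hj => by
      rw [Function.extend_apply' _ _ _ hj]; rfl
    refine ⟨(Function.extend e q 0, Function.extend e z fun _ => z hne.some), ⟨⟨?_, ?_⟩, ?_⟩, ?_⟩
    · intro j
      by_cases hj : j ∈ Set.range e
      · obtain ⟨i, rfl⟩ := hj
        simpa [e.injective.extend_apply] using (hq i).le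
      · simp [hout j hj]
    · rw [← hq1]
      exact (Fintype.sum_of_injective e e.injective _ _ hout
        fun i => (e.injective.extend_apply _ _ i).symm).symm
    · intro j _
      by_cases hj : j ∈ Set.range e
      · obtain ⟨i, rfl⟩ := hj
        simpa [e.injective.extend_apply] using hz ⟨i, rfl⟩
      · simpa [Function.extend_apply' _ _ _ hj] using hz ⟨hne.some, rfl⟩
    · refine (Fintype.sum_of_injective e e.injective _ _ (fun j hj => ?_) fun i => ?_).symm
      · simp [hout j hj]
      · simp [e.injective.extend_apply]
  · rintro _ ⟨⟨q, z⟩, ⟨hq, hz⟩, rfl⟩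
    exact (convex_convexHull ℝ s).sum_mem (fun j _ => hq.1 j) hq.2
      fun j _ => subset_convexHull ℝ s (hz j (Set.mem_univ j))

section Region

variable {X₁ X₂ Y : Type*} [Fintype X₁] [Fintype X₂] [Fintype Y]

/-- `I(X₁; Y | X₂)` for the channel `w` and the input mass function `m`. -/
def inputInfo₁ (w : X₁ × X₂ → Y → ℝ) (m : X₁ × X₂ → ℝ) : ℝ :=
  ∑ x₂, massInfo fun x₁ y => m (x₁, x₂) * w (x₁, x₂) y

/-- `I(X₂; Y | X₁)` for the channel `w` and the input mass function `m`. -/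
def inputInfo₂ (w : X₁ × X₂ → Y → ℝ) (m : X₁ × X₂ → ℝ) : ℝ :=
  ∑ x₁, massInfo fun x₂ y => m (x₁, x₂) * w (x₁, x₂) y

/-- `I(X₁, X₂; Y)` for the channel `w` and the input mass function `m`. -/
def inputInfo (w : X₁ × X₂ → Y → ℝ) (m : X₁ × X₂ → ℝ) : ℝ :=
  massInfo fun x y => m x * w x y

/-- The three informations of an input mass function, together with the mass function itself. -/
def rateVec (w : X₁ × X₂ → Y → ℝ) (m : X₁ × X₂ → ℝ) : ℝ × ℝ × ℝ × (X₁ × X₂ → ℝ) :=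
  (inputInfo₁ w m, inputInfo₂ w m, inputInfo w m, m)

/-- The rate vectors of all independent inputs with time sharing. -/
def rateRegion (w : X₁ × X₂ → Y → ℝ) : Set (ℝ × ℝ × ℝ × (X₁ × X₂ → ℝ)) :=
  convexHull ℝ ((fun p : (X₁ → ℝ) × (X₂ → ℝ) => rateVec w fun x => p.1 x.1 * p.2 x.2) ''
    (stdSimplex ℝ X₁ ×ˢ stdSimplex ℝ X₂))

lemma continuous_inputInfo (w : X₁ × X₂ → Y → ℝ) : Continuous (inputInfo w) := by
  unfold inputInfo
  exact continuous_massInfo.comp (by fun_prop)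

lemma continuous_rateVec (w : X₁ × X₂ → Y → ℝ) : Continuous (rateVec w) := by
  have h1 : Continuous (inputInfo₁ w) := by
    unfold inputInfo₁
    exact continuous_finsetSum _ fun x₂ _ => continuous_massInfo.comp (by fun_prop)
  have h2 : Continuous (inputInfo₂ w) := by
    unfold inputInfo₂
    exact continuous_finsetSum _ fun x₂ _ => continuous_massInfo.comp (by fun_prop)
  have h3 := continuous_inputInfo w
  unfold rateVec
  fun_prop

lemma isCompact_rateRegion (w : X₁ × X₂ → Y → ℝ) : IsCompact (rateRegion w) := by
  refine isCompact_convexHull_of_isCompact ?_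
  refine ((isCompact_stdSimplex ℝ X₁).prod (isCompact_stdSimplex ℝ X₂)).image ?_
  exact (continuous_rateVec w).comp (by fun_prop)

lemma rateVec_smul (w : X₁ × X₂ → Y → ℝ) (c : ℝ) (m : X₁ × X₂ → ℝ) :
    rateVec w (c • m) = c • rateVec w m := by
  simp only [rateVec, inputInfo₁, inputInfo₂, inputInfo, Pi.smul_apply, smul_eq_mul, mul_assoc,
    massInfo_const_mul, Prod.smul_mk, Finset.mul_sum]

lemma sum_rateVec_mem_rateRegion [Nonempty X₁] [Nonempty X₂] (w : X₁ × X₂ → Y → ℝ) {ι : Type*}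
    [Fintype ι] {m : ι → X₁ × X₂ → ℝ} (hm : ∀ i x, 0 ≤ m i x)
    (hprod : ∀ i x₁ x₂, m i (x₁, x₂) * ∑ x, m i x = (∑ x₂, m i (x₁, x₂)) * ∑ x₁, m i (x₁, x₂))
    (hsum : ∑ i, ∑ x, m i x = 1) : ∑ i, rateVec w (m i) ∈ rateRegion w := by
  have key : ∀ i, ∃ u ∈ rateRegion w, rateVec w (m i) = (∑ x, m i x) • u := by
    intro i
    have h0 : 0 ≤ ∑ x, m i x := Finset.sum_nonneg fun x _ => hm i x
    rcases h0.eq_or_lt with h | h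
    · have hz : m i = (0 : ℝ) • m i := by
        funext x
        rw [(Finset.sum_eq_zero_iff_of_nonneg fun x _ => hm i x).1 h.symm x (Finset.mem_univ x)]
        simp [(Finset.sum_eq_zero_iff_of_nonneg fun x _ => hm i x).1 h.symm x (Finset.mem_univ x)]
      refine ⟨_, subset_convexHull ℝ _ ⟨(Pi.single (Classical.arbitrary X₁) 1,
        Pi.single (Classical.arbitrary X₂) 1), ⟨single_mem_stdSimplex ℝ _,
          single_mem_stdSimplex ℝ _⟩, rfl⟩, ?_⟩
      rw [← h, hz, rateVec_smul, zero_smul, zero_smul]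
    · set M := ∑ x, m i x with hM
      have hM1 : ∑ x₁, ∑ x₂, m i (x₁, x₂) = M := by rw [hM, Fintype.sum_prod_type]
      have hM2 : ∑ x₂, ∑ x₁, m i (x₁, x₂) = M := by rw [Finset.sum_comm, hM1]
      refine ⟨_, subset_convexHull ℝ _ ⟨(fun x₁ => (∑ x₂, m i (x₁, x₂)) / M,
        fun x₂ => (∑ x₁, m i (x₁, x₂)) / M), ⟨⟨fun x₁ => ?_, ?_⟩, ⟨fun x₂ => ?_, ?_⟩⟩, rfl⟩, ?_⟩
      · exact div_nonneg (Finset.sum_nonneg fun _ _ => hm _ _) h.le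
      · rw [← Finset.sum_div, hM1, div_self h.ne']
      · exact div_nonneg (Finset.sum_nonneg fun _ _ => hm _ _) h.le
      · rw [← Finset.sum_div, hM2, div_self h.ne']
      · rw [← rateVec_smul]
        congr 1
        funext x
        have := hprod i x.1 x.2
        simp only [Pi.smul_apply, smul_eq_mul]
        field_simp
        rw [← this]
  choose u hu hue using key
  simp only [hue]
  exact (convex_convexHull ℝ _).sum_mem (fun i _ => Finset.sum_nonneg fun x _ => hm i x) hsum
    fun i _ => hu i

lemma exists_of_mem_rateRegion {w : X₁ × X₂ → Y → ℝ} {v} (hv : v ∈ rateRegion w) :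
    ∃ (k : ℕ) (q : Fin k → ℝ) (p₁ : Fin k → X₁ → ℝ) (p₂ : Fin k → X₂ → ℝ),
      (∀ j, 0 ≤ q j) ∧ ∑ j, q j = 1 ∧ (∀ j, p₁ j ∈ stdSimplex ℝ X₁) ∧
      (∀ j, p₂ j ∈ stdSimplex ℝ X₂) ∧
      v = ∑ j, rateVec w (fun x => q j * (p₁ j x.1 * p₂ j x.2)) := by
  obtain ⟨ι, _, q, z, hq, hq1, hz, rfl⟩ := mem_convexHull_iff_exists_fintype.1 hv
  choose p hp hpz using hz
  let e := Fintype.equivFin ι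
  refine ⟨Fintype.card ι, fun j => q (e.symm j), fun j => (p (e.symm j)).1,
    fun j => (p (e.symm j)).2, fun j => hq _, ?_, fun j => (hp _).1, fun j => (hp _).2, ?_⟩
  · rw [← hq1]; exact e.symm.sum_comp q
  · rw [e.symm.sum_comp (fun i => rateVec w (fun x => q i * ((p i).1 x.1 * (p i).2 x.2)))]
    refine Finset.sum_congr rfl fun i _ => ?_
    rw [← hpz, ← rateVec_smul]
    rfl

end Region

/-! ### The converse for a finite conditioning variable -/

lemma marg_congr {Ω A B : Type*} [Fintype Ω] (μ : Ω → ℝ) {X : Ω → A} {X' : Ω → B} {a : A} {b : B}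
    (h : ∀ ω, X ω = a ↔ X' ω = b) : marg μ X a = marg μ X' b := by
  simp only [marg, h]

section Converse

variable {S₁ S₂ Z X₁ X₂ Y T₁ T₂ : Type*} {n : ℕ}

/-- The channel inputs of a code, as functions of a source block with side variables. -/
def Code.input (c : Code S₁ S₂ X₁ X₂ Y T₁ T₂ n) (i : Fin n) (s : Fin n → (S₁ × S₂) × Z) :
    X₁ × X₂ :=
  (c.enc₁ (fun k => (s k).1.1) i, c.enc₂ (fun k => (s k).1.2) i)

variable [Fintype S₁] [Fintype S₂] [Fintype Z] [Fintype Y]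

/-- The mass function of `(S₁, Ŝ₁, Z)` at a uniformly random time. -/
def Code.testMass₁ (c : Code S₁ S₂ X₁ X₂ Y T₁ T₂ n) (r : (S₁ × S₂) × Z → ℝ)
    (w : X₁ × X₂ → Y → ℝ) (z : Z) (s : S₁) (t : T₁) : ℝ :=
  ∑ i : Fin n, (n : ℝ)⁻¹ * marg (blockMass r w c.input)
    (fun ω => ((ω.1 i).1.1, c.dec₁ ω.2 i, (ω.1 i).2)) (s, t, z)

/-- The mass function of `(S₂, Ŝ₂, Z)` at a uniformly random time. -/
def Code.testMass₂ (c : Code S₁ S₂ X₁ X₂ Y T₁ T₂ n) (r : (S₁ × S₂) × Z → ℝ)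
    (w : X₁ × X₂ → Y → ℝ) (z : Z) (s : S₂) (t : T₂) : ℝ :=
  ∑ i : Fin n, (n : ℝ)⁻¹ * marg (blockMass r w c.input)
    (fun ω => ((ω.1 i).1.2, c.dec₂ ω.2 i, (ω.1 i).2)) (s, t, z)

/-- The mass function of `(S₁, S₂, Ŝ₁, Ŝ₂)` at a uniformly random time. -/
def Code.testMass (c : Code S₁ S₂ X₁ X₂ Y T₁ T₂ n) (r : (S₁ × S₂) × Z → ℝ)
    (w : X₁ × X₂ → Y → ℝ) (s : S₁ × S₂) (t : T₁ × T₂) : ℝ :=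
  ∑ i : Fin n, (n : ℝ)⁻¹ * marg (blockMass r w c.input)
    (fun ω => ((ω.1 i).1, (c.dec₁ ω.2 i, c.dec₂ ω.2 i))) (s, t)

lemma Code.sum_testMass₁ [Fintype T₁] (c : Code S₁ S₂ X₁ X₂ Y T₁ T₂ n) (hn : 0 < n)
    {r : (S₁ × S₂) × Z → ℝ} (hr1 : ∑ a, r a = 1) {w : X₁ × X₂ → Y → ℝ}
    (hw : ∀ a, ∑ y, w a y = 1) (z : Z) (s : S₁) :
    ∑ t, c.testMass₁ r w z s t = marg r (fun a => (a.1.1, a.2)) (s, z) := by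
  simp only [Code.testMass₁]
  rw [Finset.sum_comm]
  simp only [← Finset.mul_sum, sum_marg_triple_mid,
    marg_blockMass_letter hr1 hw (fun a : (S₁ × S₂) × Z => (a.1.1, a.2))]
  have : (n : ℝ) ≠ 0 := by positivity
  simp [this]

lemma Code.sum_testMass₂ [Fintype T₂] (c : Code S₁ S₂ X₁ X₂ Y T₁ T₂ n) (hn : 0 < n)
    {r : (S₁ × S₂) × Z → ℝ} (hr1 : ∑ a, r a = 1) {w : X₁ × X₂ → Y → ℝ}
    (hw : ∀ a, ∑ y, w a y = 1) (z : Z) (s : S₂) :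
    ∑ t, c.testMass₂ r w z s t = marg r (fun a => (a.1.2, a.2)) (s, z) := by
  simp only [Code.testMass₂]
  rw [Finset.sum_comm]
  simp only [← Finset.mul_sum, sum_marg_triple_mid,
    marg_blockMass_letter hr1 hw (fun a : (S₁ × S₂) × Z => (a.1.2, a.2))]
  have : (n : ℝ) ≠ 0 := by positivity
  simp [this]

lemma Code.sum_testMass [Fintype T₁] [Fintype T₂] (c : Code S₁ S₂ X₁ X₂ Y T₁ T₂ n) (hn : 0 < n)
    {r : (S₁ × S₂) × Z → ℝ} (hr1 : ∑ a, r a = 1) {w : X₁ × X₂ → Y → ℝ}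
    (hw : ∀ a, ∑ y, w a y = 1) (s : S₁ × S₂) :
    ∑ t, c.testMass r w s t = marg r (fun a => a.1) s := by
  simp only [Code.testMass]
  rw [Finset.sum_comm]
  simp only [← Finset.mul_sum, sum_marg_prodMk_right,
    marg_blockMass_letter hr1 hw (fun a : (S₁ × S₂) × Z => a.1)]
  have : (n : ℝ) ≠ 0 := by positivity
  simp [this]

/-- The converse for a code of length `n` and a finite variable `Z` with `S₁ - Z - S₂`. -/
theorem Code.exists_rateVec [Fintype X₁] [Fintype X₂] [Fintype T₁] [Fintype T₂] [Nonempty X₁] [Nonempty X₂]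
    (c : Code S₁ S₂ X₁ X₂ Y T₁ T₂ n)
    (hn : 0 < n) {r : (S₁ × S₂) × Z → ℝ} (hr : ∀ a, 0 ≤ r a) (hr1 : ∑ a, r a = 1)
    (hind : CondIndep r (fun a => a.1.1) (fun a => a.1.2) (fun a => a.2))
    {w : X₁ × X₂ → Y → ℝ} (hw0 : ∀ a y, 0 ≤ w a y) (hw : ∀ a, ∑ y, w a y = 1) :
    ∃ v ∈ rateRegion w,
      ∑ z, massInfo (c.testMass₁ r w z) ≤ v.1 ∧
      ∑ z, massInfo (c.testMass₂ r w z) ≤ v.2.1 ∧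
      ∑ z, massInfo (c.testMass₁ r w z) + ∑ z, massInfo (c.testMass₂ r w z) ≤ v.2.2.1 ∧
      massInfo (c.testMass r w) ≤ inputInfo w v.2.2.2 := by
  set μ : (Fin n → (S₁ × S₂) × Z) × (Fin n → Y) → ℝ := blockMass r w c.input with hμdef
  have hμ : ∀ t, 0 ≤ μ t := blockMass_nonneg hr hw0
  have hn0 : (n : ℝ) ≠ 0 := by positivity
  have hninv : (0 : ℝ) ≤ (n : ℝ)⁻¹ := by positivity
  have hninv1 : ∑ _i : Fin n, (n : ℝ)⁻¹ = 1 := by simp [hn0]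
  let zs : (Fin n → (S₁ × S₂) × Z) → (Fin n → Z) := fun s j => (s j).2
  let m : Fin n × (Fin n → Z) → X₁ × X₂ → ℝ := fun q x =>
    (n : ℝ)⁻¹ * marg μ (fun ω => (c.input q.1 ω.1, zs ω.1)) (x, q.2)
  have hCI : CondIndep μ (fun t j => (t.1 j).1.1) (fun t j => (t.1 j).1.2) (fun t => zs t.1) :=
    condIndep_blockMass hw hind
  have hCI' : CondIndep μ (fun t j => (t.1 j).1.2) (fun t j => (t.1 j).1.1) (fun t => zs t.1) := by
    intro a b e
    rw [mul_comm (marg μ _ (a, e)), ← hCI b a e]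
    congr 1
    exact marg_congr μ (by grind)
  -- the mass function of an output letter
  have hout : ∀ i x y z, marg μ (fun t => (c.input i t.1, t.2 i, zs t.1)) (x, y, z) =
      marg μ (fun t => (c.input i t.1, zs t.1)) (x, z) * w x y := by
    intro i x y z
    rw [← marg_output hw i (D := fun s => (c.input i s, zs s)) (ξ := fun e => e.1)
      (fun _ => rfl) y (x, z)]
    exact marg_congr μ (by grind)
  have hout' : ∀ i x y, marg μ (fun t => (c.input i t.1, t.2 i, ())) (x, y, ()) =
      marg μ (fun t => c.input i t.1) x * w x y := by
    intro i x y
    rw [← marg_output hw i (D := fun s => c.input i s) (ξ := fun e => e) (fun _ => rfl) y x]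
    exact marg_congr μ (by grind)
  -- the components of the rate vector
  have hv1 : ∑ q, inputInfo₁ w (m q) = ∑ i, (n : ℝ)⁻¹ * cmi μ (fun t => (c.input i t.1).1)
      (fun t => t.2 i) (fun t => ((c.input i t.1).2, zs t.1)) := by
    rw [Fintype.sum_prod_type]
    refine Finset.sum_congr rfl fun i _ => ?_
    rw [cmi_eq_sum, Fintype.sum_prod_type_right, Finset.mul_sum]
    refine Finset.sum_congr rfl fun z _ => ?_
    rw [inputInfo₁, Finset.mul_sum]
    refine Finset.sum_congr rfl fun x₂ _ => ?_
    rw [← massInfo_const_mul]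
    congr 1
    funext x₁ y
    simp only [m, mul_assoc, ← hout]
    congr 1
    exact marg_congr μ (by grind)
  have hv2 : ∑ q, inputInfo₂ w (m q) = ∑ i, (n : ℝ)⁻¹ * cmi μ (fun t => (c.input i t.1).2)
      (fun t => t.2 i) (fun t => ((c.input i t.1).1, zs t.1)) := by
    rw [Fintype.sum_prod_type]
    refine Finset.sum_congr rfl fun i _ => ?_
    rw [cmi_eq_sum, Fintype.sum_prod_type_right, Finset.mul_sum]
    refine Finset.sum_congr rfl fun z _ => ?_
    rw [inputInfo₂, Finset.mul_sum]
    refine Finset.sum_congr rfl fun x₂ _ => ?_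
    rw [← massInfo_const_mul]
    congr 1
    funext x₁ y
    simp only [m, mul_assoc, ← hout]
    congr 1
    exact marg_congr μ (by grind)
  have hv3 : ∑ q, inputInfo w (m q) = ∑ i, (n : ℝ)⁻¹ * cmi μ (fun t => c.input i t.1)
      (fun t => t.2 i) (fun t => zs t.1) := by
    rw [Fintype.sum_prod_type]
    refine Finset.sum_congr rfl fun i _ => ?_
    rw [cmi_eq_sum, Finset.mul_sum]
    refine Finset.sum_congr rfl fun z _ => ?_
    rw [inputInfo, ← massInfo_const_mul]
    congr 1
    funext x y
    simp only [m, mul_assoc, ← hout]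
  have hv4 : ∀ x, ∑ q, m q x = ∑ i, (n : ℝ)⁻¹ * marg μ (fun t => c.input i t.1) x := by
    intro x
    simp only [m, Fintype.sum_prod_type, ← Finset.mul_sum, sum_marg_prodMk_right]
  -- the test channels
  have ht1 : ∑ z, massInfo (c.testMass₁ r w z) ≤ (n : ℝ)⁻¹ *
      cmi μ (fun t j => (t.1 j).1.1) (fun t => t.2) (fun t => zs t.1) := by
    refine le_trans ?_ (mul_le_mul_of_nonneg_left (sum_cmi_letter_le hr hr1 hw0 hw
      (fun a : (S₁ × S₂) × Z => a.1.1) (fun a => a.2) fun i y => c.dec₁ y i) hninv)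
    simp only [cmi_eq_sum, Finset.mul_sum]
    rw [Finset.sum_comm]
    refine Finset.sum_le_sum fun z _ => ?_
    refine massInfo_sum_le (fun _ => hninv) hninv1 (fun _ _ _ => marg_nonneg hμ _ _)
      (g := fun s => marg r (fun a => (a.1.1, a.2)) (s, z)) ?_
    intro i s
    rw [sum_marg_triple_mid, marg_blockMass_letter hr1 hw fun a : (S₁ × S₂) × Z => (a.1.1, a.2)]
  have ht2 : ∑ z, massInfo (c.testMass₂ r w z) ≤ (n : ℝ)⁻¹ *
      cmi μ (fun t j => (t.1 j).1.2) (fun t => t.2) (fun t => zs t.1) := by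
    refine le_trans ?_ (mul_le_mul_of_nonneg_left (sum_cmi_letter_le hr hr1 hw0 hw
      (fun a : (S₁ × S₂) × Z => a.1.2) (fun a => a.2) fun i y => c.dec₂ y i) hninv)
    simp only [cmi_eq_sum, Finset.mul_sum]
    rw [Finset.sum_comm]
    refine Finset.sum_le_sum fun z _ => ?_
    refine massInfo_sum_le (fun _ => hninv) hninv1 (fun _ _ _ => marg_nonneg hμ _ _)
      (g := fun s => marg r (fun a => (a.1.2, a.2)) (s, z)) ?_
    intro i s
    rw [sum_marg_triple_mid, marg_blockMass_letter hr1 hw fun a : (S₁ × S₂) × Z => (a.1.2, a.2)]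
  have ht4 : massInfo (c.testMass r w) ≤ (n : ℝ)⁻¹ *
      cmi μ (fun t j => (t.1 j).1) (fun t => t.2) (fun t (_ : Fin n) => ()) := by
    refine le_trans ?_ (mul_le_mul_of_nonneg_left (sum_cmi_letter_le hr hr1 hw0 hw
      (fun a : (S₁ × S₂) × Z => a.1) (fun _ => ()) fun i y => (c.dec₁ y i, c.dec₂ y i)) hninv)
    simp only [cmi_eq_sum, Finset.mul_sum, Finset.univ_unique, Finset.sum_singleton]
    refine le_of_eq_of_le ?_ (massInfo_sum_le (fun _ => hninv) hninv1
      (fun _ _ _ => marg_nonneg hμ _ _) (g := fun s => marg r (fun a => a.1) s) ?_)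
    · congr 1
      funext s t
      refine Finset.sum_congr rfl fun i _ => ?_
      congr 1
      exact marg_congr _ (by grind)
    · intro i s
      rw [sum_marg_triple_mid, ← marg_blockMass_letter (x := c.input) hr1 hw
        (fun a : (S₁ × S₂) × Z => a.1) i]
      exact marg_congr _ (by grind)
  refine ⟨∑ q, rateVec w (m q), sum_rateVec_mem_rateRegion w ?_ ?_ ?_, ?_, ?_, ?_, ?_⟩
  · exact fun q x => mul_nonneg hninv (marg_nonneg hμ _ _)
  · intro q x₁ x₂
    have h := hCI.comp (fun s => c.enc₁ s q.1) (fun s => c.enc₂ s q.1) x₁ x₂ q.2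
    have h1 : marg μ (fun ω => (c.input q.1 ω.1, zs ω.1)) ((x₁, x₂), q.2) =
      marg μ (fun ω => (c.enc₁ (fun j => (ω.1 j).1.1) q.1, c.enc₂ (fun j => (ω.1 j).1.2) q.1,
        zs ω.1)) (x₁, x₂, q.2) := marg_congr μ (by simp [Code.input, and_assoc])
    have h2 : ∑ x, marg μ (fun ω => (c.input q.1 ω.1, zs ω.1)) (x, q.2) =
      marg μ (fun ω => zs ω.1) q.2 := sum_marg_prodMk_left _ _ _ _
    have h3 : ∑ x₂, marg μ (fun ω => (c.input q.1 ω.1, zs ω.1)) ((x₁, x₂), q.2) =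
      marg μ (fun ω => (c.enc₁ (fun j => (ω.1 j).1.1) q.1, zs ω.1)) (x₁, q.2) := by
      rw [← sum_marg_triple_mid μ _ (fun ω => c.enc₂ (fun j => (ω.1 j).1.2) q.1)]
      exact Finset.sum_congr rfl fun _ _ => marg_congr μ (by simp [Code.input, and_assoc])
    have h4 : ∑ x₁, marg μ (fun ω => (c.input q.1 ω.1, zs ω.1)) ((x₁, x₂), q.2) =
      marg μ (fun ω => (c.enc₂ (fun j => (ω.1 j).1.2) q.1, zs ω.1)) (x₂, q.2) := by
      rw [← sum_marg_prodMk_left μ (fun ω => c.enc₁ (fun j => (ω.1 j).1.1) q.1)]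
      exact Finset.sum_congr rfl fun _ _ => marg_congr μ (by simp [Code.input, and_assoc])
    simp only [m, ← Finset.mul_sum, h2, h3, h4]
    rw [h1]
    linear_combination (n : ℝ)⁻¹ * (n : ℝ)⁻¹ * h
  · rw [Finset.sum_comm]
    simp only [hv4]
    rw [Finset.sum_comm]
    simp only [← Finset.mul_sum, sum_marg]
    have : ∑ t, μ t = 1 := by
      have := sum_blockMass_source (r := r) (x := c.input) hw fun _ => 1
      simp only [mul_one] at this
      rw [hμdef, this, sum_pi_prod (fun _ => r) fun _ => hr1]
    simp [this, hn0]
  · simp only [Prod.fst_sum, rateVec, hv1]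
    refine ht1.trans ?_
    rw [← Finset.mul_sum]
    refine mul_le_mul_of_nonneg_left ?_ hninv
    exact cmi_le_sum_cmi_of_condIndep hr hr1 hw0 hw
      (F := fun s j => (s j).1.1) (H := fun s j => (s j).1.2) (K := zs) hCI
      (fun i s => (c.input i s).1) (fun i s => c.enc₂ s i)
      (fun i s s' h h' => Prod.ext h h')
  · simp only [Prod.fst_sum, Prod.snd_sum, rateVec, hv2]
    refine ht2.trans ?_
    rw [← Finset.mul_sum]
    refine mul_le_mul_of_nonneg_left ?_ hninv
    exact cmi_le_sum_cmi_of_condIndep hr hr1 hw0 hw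
      (F := fun s j => (s j).1.2) (H := fun s j => (s j).1.1) (K := zs) hCI'
      (fun i s => (c.input i s).2) (fun i s => c.enc₁ s i)
      (fun i s s' h h' => Prod.ext h' h)
  · simp only [Prod.fst_sum, Prod.snd_sum, rateVec, hv3]
    refine (add_le_add ht1 ht2).trans ?_
    rw [← Finset.mul_sum, ← mul_add]
    refine mul_le_mul_of_nonneg_left ?_ hninv
    exact cmi_add_cmi_le_sum_cmi hr hr1 hw0 hw
      (F := fun s j => (s j).1.1) (H := fun s j => (s j).1.2) (K := zs) hCI
  · simp only [Prod.snd_sum, rateVec]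
    refine ht4.trans ?_
    have e1 := cmi_le_sum_cmi_input (x := c.input) hr hr1 hw0 hw
      (fun (s : Fin n → (S₁ × S₂) × Z) j => (s j).1) fun _ => ()
    have e2 : cmi μ (fun t j => (t.1 j).1) (fun t => t.2) (fun t (_ : Fin n) => ()) =
        cmi μ (fun t j => (t.1 j).1) (fun t => t.2) (fun _ => ()) := by
      simp only [cmi]
      congr 1
      · congr 1
        · congr 1 <;> exact ent_congr μ (by simp)
        · exact ent_congr μ (by simp)
      · exact ent_congr μ (by simp)
    rw [e2]
    refine (mul_le_mul_of_nonneg_left e1 hninv).trans ?_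
    rw [Finset.mul_sum]
    simp only [cmi_eq_sum, Finset.univ_unique, Finset.sum_singleton]
    refine le_of_le_of_eq (le_of_eq_of_le ?_ (sum_massInfo_le (fun _ => hninv) hninv1
      (m := fun i x => marg μ (fun t => c.input i t.1) x) (fun i x => marg_nonneg hμ _ _)
      (fun i => ?_) hw0 hw)) ?_
    · refine Finset.sum_congr rfl fun i _ => ?_
      congr 2
      funext x y
      exact hout' i x y
    · rw [sum_marg]
      have := sum_blockMass_source (r := r) (x := c.input) hw fun _ => 1
      simp only [mul_one] at this
      rw [hμdef, this, sum_pi_prod (fun _ => r) fun _ => hr1]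
    · rw [inputInfo]
      congr 1
      funext x y
      rw [Finset.sum_apply, hv4]

end Converse

/-! ### Probability mass functions and rate distortion functions -/

section Prob

variable {Ω A B C : Type*}

lemma summable_toReal (P : PMF Ω) : Summable fun ω => (P ω).toReal :=
  ENNReal.summable_toReal P.tsum_coe_ne_top

lemma tsum_toReal (P : PMF Ω) : ∑' ω, (P ω).toReal = 1 := by
  rw [← ENNReal.tsum_toReal_eq fun ω => P.apply_ne_top ω, P.tsum_coe, ENNReal.toReal_one]

lemma sum_toReal [Fintype Ω] (P : PMF Ω) : ∑ ω, (P ω).toReal = 1 := by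
  rw [← tsum_toReal P, tsum_fintype]

lemma summable_ite_toReal (P : PMF Ω) (p : Ω → Prop) :
    Summable fun ω => if p ω then (P ω).toReal else 0 :=
  Summable.of_nonneg_of_le (fun ω => by split_ifs <;> simp)
    (fun ω => by split_ifs <;> simp) (summable_toReal P)

lemma prob_eq_tsum (P : PMF Ω) (X : Ω → A) (a : A) :
    prob P X a = ∑' ω, if X ω = a then (P ω).toReal else 0 := by
  rw [prob, PMF.map_apply, ENNReal.tsum_toReal_eq]
  · refine tsum_congr fun ω => ?_
    by_cases h : X ω = a
    · simp [h]
    · simp [h, Ne.symm h]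
  · intro ω
    split_ifs
    · exact P.apply_ne_top ω
    · simp

lemma prob_nonneg (P : PMF Ω) (X : Ω → A) (a : A) : 0 ≤ prob P X a := ENNReal.toReal_nonneg

lemma prob_of_fiber (P : PMF Ω) {X : Ω → A} {a : A} {ω : Ω} (h : ∀ ω', X ω' = a ↔ ω' = ω) :
    prob P X a = (P ω).toReal := by
  rw [prob_eq_tsum, tsum_eq_single ω]
  · simp [(h ω).2 rfl]
  · intro ω' hω'
    simp [h, hω']

lemma sum_prob_mid [Fintype B] (P : PMF Ω) (X : Ω → A) (Y : Ω → B) (Z : Ω → C) (a : A) (c : C) :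
    ∑ b, prob P (fun ω => (X ω, Y ω, Z ω)) (a, b, c) = prob P (fun ω => (X ω, Z ω)) (a, c) := by
  simp only [prob_eq_tsum]
  rw [← Summable.tsum_finsetSum fun b _ => summable_ite_toReal P _]
  refine tsum_congr fun ω => ?_
  by_cases h : X ω = a <;> by_cases h' : Z ω = c <;> simp [h, h']

lemma sum_prob_left [Fintype A] (P : PMF Ω) (X : Ω → A) (Y : Ω → B) (b : B) :
    ∑ a, prob P (fun ω => (X ω, Y ω)) (a, b) = prob P Y b := by
  simp only [prob_eq_tsum]
  rw [← Summable.tsum_finsetSum fun b _ => summable_ite_toReal P _]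
  refine tsum_congr fun ω => ?_
  by_cases h : Y ω = b <;> simp [h]

lemma sum_prob_right [Fintype B] (P : PMF Ω) (X : Ω → A) (Y : Ω → B) (a : A) :
    ∑ b, prob P (fun ω => (X ω, Y ω)) (a, b) = prob P X a := by
  simp only [prob_eq_tsum]
  rw [← Summable.tsum_finsetSum fun b _ => summable_ite_toReal P _]
  refine tsum_congr fun ω => ?_
  by_cases h : X ω = a <;> simp [h]

lemma sum_prob [Fintype A] (P : PMF Ω) (X : Ω → A) : ∑ a, prob P X a = 1 :=
  sum_toReal (P.map X)

lemma condMutualInfo_eq_tsum [Fintype A] [Fintype B] (P : PMF Ω) (X : Ω → A) (Y : Ω → B)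
    (Z : Ω → C) : condMutualInfo P X Y Z =
      ∑' c, massInfo fun a b => prob P (fun ω => (X ω, Y ω, Z ω)) (a, b, c) := by
  refine tsum_congr fun c => ?_
  rw [massInfo_eq fun a b => prob_nonneg _ _ _]
  have h1 : ∀ b, ∑ a, prob P (fun ω => (X ω, Y ω, Z ω)) (a, b, c) =
      prob P (fun ω => (Y ω, Z ω)) (b, c) := fun b =>
    sum_prob_left P X (fun ω => (Y ω, Z ω)) (b, c)
  simp only [sum_prob_mid, h1, sum_prob_left]

lemma mutualInfo_eq [Fintype A] [Fintype B] (P : PMF Ω) (X : Ω → A) (Y : Ω → B) :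
    mutualInfo P X Y = massInfo fun a b => prob P (fun ω => (X ω, Y ω)) (a, b) := by
  rw [massInfo_eq fun a b => prob_nonneg _ _ _]
  simp only [sum_prob_left, sum_prob_right, sum_prob, mul_one, mutualInfo]

lemma joint_apply (P : PMF A) (κ : A → PMF B) (a : A) (b : B) :
    joint P κ (a, b) = P a * κ a b := by
  rw [joint, PMF.bind_apply, tsum_eq_single a]
  · rw [PMF.map_apply, tsum_eq_single b]
    · simp
    · intro b' hb'
      simp [Ne.symm hb']
  · intro a' ha'
    rw [PMF.map_apply]
    simp [Ne.symm ha']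

/-- A conditional law with prescribed joint masses. -/
lemma exists_pmf_mul_eq [Fintype A] [Nonempty A] {c : ℝ} {q : A → ℝ} (hq : ∀ a, 0 ≤ q a)
    (hc : ∑ a, q a = c) : ∃ κ : PMF A, ∀ a, c * (κ a).toReal = q a := by
  have hc0 : 0 ≤ c := hc ▸ Finset.sum_nonneg fun a _ => hq a
  rcases hc0.eq_or_lt with h | h
  · refine ⟨PMF.pure (Classical.arbitrary A), fun a => ?_⟩
    rw [← h] at hc
    rw [(Finset.sum_eq_zero_iff_of_nonneg fun a _ => hq a).1 hc a (Finset.mem_univ a), ← h,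
      zero_mul]
  · refine ⟨PMF.ofFintype (fun a => ENNReal.ofReal (q a / c)) ?_, fun a => ?_⟩
    · rw [← ENNReal.ofReal_sum_of_nonneg fun a _ => div_nonneg (hq a) h.le, ← Finset.sum_div, hc,
        div_self h.ne', ENNReal.ofReal_one]
    · rw [PMF.ofFintype_apply, ENNReal.toReal_ofReal (div_nonneg (hq a) h.le)]
      field_simp

lemma massInfo_equiv [Fintype A] [Fintype B] {B' : Type*} [Fintype B'] (f : A → B → ℝ)
    (e : B' ≃ B) : massInfo (fun a b' => f a (e b')) = massInfo f := by
  have h1 : ∀ a, ∑ b', f a (e b') = ∑ b, f a b := fun a => e.sum_comp (f a)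
  have h2 : ∀ a, ∑ b', negMulLog (f a (e b')) = ∑ b, negMulLog (f a b) := fun a =>
    e.sum_comp fun b => negMulLog (f a b)
  have h3 : ∑ b', negMulLog (∑ a, f a (e b')) = ∑ b, negMulLog (∑ a, f a b) :=
    e.sum_comp fun b => negMulLog (∑ a, f a b)
  simp only [massInfo, h1, h2, h3]

end Prob

section RateDistortion

lemma condRateDistortion_le {S T Z : Type*} [Fintype S] [Fintype T] (P : PMF (S × Z))
    {d : S → T → ℝ} {D C : ℝ} (hC : ∀ s t, 0 ≤ d s t + C) {f : Z → S → T → ℝ}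
    (hf : ∀ z s t, 0 ≤ f z s t) (hP : ∀ z s, ∑ t, f z s t = (P (s, z)).toReal)
    (hd : ∀ F : Finset Z, ∑ z ∈ F, ∑ s, ∑ t, f z s t * (d s t + C) ≤ D + C) :
    condRateDistortion P d D ≤ ((∑' z, massInfo (f z) : ℝ) : EReal) := by
  have hT : Nonempty T := by
    by_contra hT
    rw [not_nonempty_iff] at hT
    have h0 : ∀ a, (P a).toReal = 0 := fun a => by rw [← hP a.2 a.1]; simp
    have := tsum_toReal P
    simp [h0] at this
  let e := Fintype.equivFin T
  have : Nonempty (Fin (Fintype.card T)) := ⟨e hT.some⟩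
  have hex : ∀ a : S × Z, ∃ κ : PMF (Fin (Fintype.card T)), ∀ u,
      (P a).toReal * (κ u).toReal = f a.2 a.1 (e.symm u) := fun a =>
    exists_pmf_mul_eq (fun u => hf _ _ _) ((e.symm.sum_comp (f a.2 a.1)).trans (hP a.2 a.1))
  choose κ hκ using hex
  have hj : ∀ s z u, (joint P κ ((s, z), u)).toReal = f z s (e.symm u) := fun s z u => by
    rw [joint_apply, ENNReal.toReal_mul, hκ]
  refine iInf_le_of_le (Fintype.card T) (iInf_le_of_le κ (iInf_le_of_le ?_ (le_of_eq ?_)))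
  · refine iInf_le_of_le (fun q => e.symm q.1) ?_
    rw [EReal.coe_le_coe_iff, expect]
    set J := joint P κ
    obtain ⟨M, hM⟩ : ∃ M, ∀ a : S × T, d a.1 a.2 + C ≤ M := by
      obtain ⟨M, hM⟩ := (Set.finite_range fun a : S × T => d a.1 a.2 + C).bddAbove
      exact ⟨M, fun a => hM ⟨a, rfl⟩⟩
    have hs1 : Summable fun ω => (J ω).toReal * (d ω.1.1 (e.symm ω.2) + C) :=
      Summable.of_nonneg_of_le (fun ω => mul_nonneg ENNReal.toReal_nonneg (hC _ _))
        (fun ω => mul_le_mul_of_nonneg_left (hM (ω.1.1, e.symm ω.2)) ENNReal.toReal_nonneg)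
        ((summable_toReal J).mul_right M)
    have hs2 : Summable fun ω => (J ω).toReal * C := (summable_toReal J).mul_right C
    have h1 : ∑' ω, (J ω).toReal * d ω.1.1 (e.symm ω.2) =
        ∑' ω, (J ω).toReal * (d ω.1.1 (e.symm ω.2) + C) - C := by
      have h2 : ∑' ω, (J ω).toReal * C = C := by rw [tsum_mul_right, tsum_toReal, one_mul]
      refine Eq.trans ?_ ((hs1.tsum_sub hs2).trans (by rw [h2]))
      exact tsum_congr fun ω => by ring
    rw [h1, sub_le_iff_le_add]
    refine Real.tsum_le_of_sum_le (fun ω => mul_nonneg ENNReal.toReal_nonneg (hC _ _)) ?_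
    intro u
    refine le_trans ?_ (hd (u.image fun ω => ω.1.2))
    have hsub : u ⊆ ((univ : Finset S) ×ˢ (u.image fun ω => ω.1.2)) ×ˢ univ := by
      intro ω hω
      simp only [Finset.mem_product, Finset.mem_univ, true_and, and_true]
      exact Finset.mem_image_of_mem _ hω
    refine (Finset.sum_le_sum_of_subset_of_nonneg hsub
      fun ω _ _ => mul_nonneg ENNReal.toReal_nonneg (hC _ _)).trans (le_of_eq ?_)
    rw [Finset.sum_product, Finset.sum_product_right]
    refine Finset.sum_congr rfl fun z _ => Finset.sum_congr rfl fun s _ => ?_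
    simp only [J, hj]
    exact e.symm.sum_comp fun t => f z s t * (d s t + C)
  · rw [condMutualInfo_eq_tsum]
    congr 1
    refine tsum_congr fun z => ?_
    rw [← massInfo_equiv (f z) e.symm]
    congr 1
    funext s u
    rw [prob_of_fiber _ (ω := ((s, z), u)) (by grind), hj]

lemma jointRateDistortion_le {S₁ S₂ T₁ T₂ : Type*} [Fintype S₁] [Fintype S₂] [Fintype T₁]
    [Fintype T₂] (P : PMF (S₁ × S₂)) {d₁ : S₁ → T₁ → ℝ} {d₂ : S₂ → T₂ → ℝ} {D₁ D₂ : ℝ}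
    {f : S₁ × S₂ → T₁ × T₂ → ℝ} (hf : ∀ s t, 0 ≤ f s t) (hP : ∀ s, ∑ t, f s t = (P s).toReal)
    (hd₁ : ∑ s, ∑ t, f s t * d₁ s.1 t.1 ≤ D₁) (hd₂ : ∑ s, ∑ t, f s t * d₂ s.2 t.2 ≤ D₂) :
    jointRateDistortion P d₁ d₂ D₁ D₂ ≤ ((massInfo f : ℝ) : EReal) := by
  have hT : Nonempty (T₁ × T₂) := by
    by_contra hT
    rw [not_nonempty_iff] at hT
    have h0 : ∀ a, (P a).toReal = 0 := fun a => by rw [← hP a]; simp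
    have := tsum_toReal P
    simp [h0] at this
  choose κ hκ using fun s => exists_pmf_mul_eq (hf s) (hP s)
  have hj : ∀ s t, (joint P κ (s, t)).toReal = f s t := fun s t => by
    rw [joint_apply, ENNReal.toReal_mul, hκ]
  refine iInf_le_of_le κ (iInf_le_of_le ?_ (iInf_le_of_le ?_ (le_of_eq ?_)))
  · rw [expect, tsum_fintype, Fintype.sum_prod_type]
    simpa only [hj] using hd₁
  · rw [expect, tsum_fintype, Fintype.sum_prod_type]
    simpa only [hj] using hd₂
  · rw [mutualInfo_eq]
    congr 2
    funext s t
    rw [prob_of_fiber _ (ω := (s, t)) (by grind), hj]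

end RateDistortion

/-! ### Distortions of a code -/

section Distortion

variable {S₁ S₂ Z X₁ X₂ Y T₁ T₂ : Type*} [Fintype S₁] [Fintype S₂] [Fintype Z] [Fintype Y] {n : ℕ}

lemma Code.expect_law (c : Code S₁ S₂ X₁ X₂ Y T₁ T₂ n) {p : PMF (S₁ × S₂)}
    {W : X₁ × X₂ → PMF Y} {r : (S₁ × S₂) × Z → ℝ}
    (hp : ∀ s, marg r (fun a => a.1) s = (p s).toReal)
    (g : (Fin n → S₁ × S₂) × (Fin n → Y) → ℝ) :
    expect (c.law p W) g = ∑ ω, blockMass r (fun x y => (W x y).toReal) c.input ω *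
      g ((fun j => (ω.1 j).1), ω.2) := by
  rw [← sum_marg_mul _ (fun ω : (Fin n → (S₁ × S₂) × Z) × (Fin n → Y) =>
    ((fun j => (ω.1 j).1), ω.2)) g, expect, tsum_fintype]
  refine Finset.sum_congr rfl fun t _ => ?_
  congr 1
  obtain ⟨s, y⟩ := t
  have hw : ∀ a, ∑ y, (W a y).toReal = 1 := fun a => sum_toReal (W a)
  rw [Code.law, joint_apply, prodPMF, prodPMF, PMF.ofFintype_apply, PMF.ofFintype_apply,
    ENNReal.toReal_mul, ENNReal.toReal_prod, ENNReal.toReal_prod]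
  simp only [← hp]
  rw [← marg_blockMass_pi (x := c.input) hw (D := fun (a : Fin n → (S₁ × S₂) × Z) j => (a j).1)
    (φ := fun a => a.1) (v := s) (b := s) (by simp [funext_iff]),
    marg_blockMass_source hw (fun (a : Fin n → (S₁ × S₂) × Z) j => (a j).1), Finset.sum_mul, marg, Fintype.sum_prod_type]
  refine Finset.sum_congr rfl fun a _ => ?_
  by_cases h : (fun j => (a j).1) = s
  · subst h
    simp [blockMass, Code.input]
  · simp [h]

lemma Code.sum_testMass₁_mul [Fintype T₁] (c : Code S₁ S₂ X₁ X₂ Y T₁ T₂ n) {p : PMF (S₁ × S₂)}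
    {W : X₁ × X₂ → PMF Y} {r : (S₁ × S₂) × Z → ℝ}
    (hp : ∀ s, marg r (fun a => a.1) s = (p s).toReal) (d : S₁ → T₁ → ℝ) :
    ∑ z, ∑ s, ∑ t, c.testMass₁ r (fun x y => (W x y).toReal) z s t * d s t =
      c.distortion₁ p W d := by
  have h : ∀ i, expect (c.law p W) (fun ω => d (ω.1 i).1 (c.dec₁ ω.2 i)) =
      ∑ z, ∑ s, ∑ t, marg (blockMass r (fun x y => (W x y).toReal) c.input)
        (fun ω => ((ω.1 i).1.1, c.dec₁ ω.2 i, (ω.1 i).2)) (s, t, z) * d s t := by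
    intro i
    rw [c.expect_law hp, ← sum_marg_mul _ (fun ω : (Fin n → (S₁ × S₂) × Z) × (Fin n → Y) =>
      ((ω.1 i).1.1, c.dec₁ ω.2 i, (ω.1 i).2)) fun q => d q.1 q.2.1]
    simp only [Fintype.sum_prod_type]
    simp only [Finset.sum_comm (s := (univ : Finset T₁)) (t := (univ : Finset Z))]
    rw [Finset.sum_comm]
  simp only [Code.distortion₁, h, Code.testMass₁, Finset.sum_mul, Finset.mul_sum, one_div]
  rw [Finset.sum_comm (s := (univ : Finset (Fin n)))]
  refine Finset.sum_congr rfl fun z _ => ?_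
  rw [Finset.sum_comm (s := (univ : Finset (Fin n)))]
  refine Finset.sum_congr rfl fun s _ => ?_
  rw [Finset.sum_comm (s := (univ : Finset (Fin n)))]
  simp only [mul_assoc]

lemma Code.sum_testMass₂_mul [Fintype T₂] (c : Code S₁ S₂ X₁ X₂ Y T₁ T₂ n) {p : PMF (S₁ × S₂)}
    {W : X₁ × X₂ → PMF Y} {r : (S₁ × S₂) × Z → ℝ}
    (hp : ∀ s, marg r (fun a => a.1) s = (p s).toReal) (d : S₂ → T₂ → ℝ) :
    ∑ z, ∑ s, ∑ t, c.testMass₂ r (fun x y => (W x y).toReal) z s t * d s t =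
      c.distortion₂ p W d := by
  have h : ∀ i, expect (c.law p W) (fun ω => d (ω.1 i).2 (c.dec₂ ω.2 i)) =
      ∑ z, ∑ s, ∑ t, marg (blockMass r (fun x y => (W x y).toReal) c.input)
        (fun ω => ((ω.1 i).1.2, c.dec₂ ω.2 i, (ω.1 i).2)) (s, t, z) * d s t := by
    intro i
    rw [c.expect_law hp, ← sum_marg_mul _ (fun ω : (Fin n → (S₁ × S₂) × Z) × (Fin n → Y) =>
      ((ω.1 i).1.2, c.dec₂ ω.2 i, (ω.1 i).2)) fun q => d q.1 q.2.1]
    simp only [Fintype.sum_prod_type]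
    simp only [Finset.sum_comm (s := (univ : Finset T₂)) (t := (univ : Finset Z))]
    rw [Finset.sum_comm]
  simp only [Code.distortion₂, h, Code.testMass₂, Finset.sum_mul, Finset.mul_sum, one_div]
  rw [Finset.sum_comm (s := (univ : Finset (Fin n)))]
  refine Finset.sum_congr rfl fun z _ => ?_
  rw [Finset.sum_comm (s := (univ : Finset (Fin n)))]
  refine Finset.sum_congr rfl fun s _ => ?_
  rw [Finset.sum_comm (s := (univ : Finset (Fin n)))]
  simp only [mul_assoc]

lemma Code.sum_testMass_mul [Fintype T₁] [Fintype T₂] (c : Code S₁ S₂ X₁ X₂ Y T₁ T₂ n)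
    {p : PMF (S₁ × S₂)} {W : X₁ × X₂ → PMF Y} {r : (S₁ × S₂) × Z → ℝ}
    (hp : ∀ s, marg r (fun a => a.1) s = (p s).toReal) (d : S₁ × S₂ → T₁ × T₂ → ℝ) :
    ∑ s, ∑ t, c.testMass r (fun x y => (W x y).toReal) s t * d s t =
      1 / (n : ℝ) * ∑ i, expect (c.law p W)
        (fun ω => d (ω.1 i) (c.dec₁ ω.2 i, c.dec₂ ω.2 i)) := by
  have h : ∀ i, expect (c.law p W) (fun ω => d (ω.1 i) (c.dec₁ ω.2 i, c.dec₂ ω.2 i)) =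
      ∑ s, ∑ t, marg (blockMass r (fun x y => (W x y).toReal) c.input)
        (fun ω => ((ω.1 i).1, (c.dec₁ ω.2 i, c.dec₂ ω.2 i))) (s, t) * d s t := by
    intro i
    rw [c.expect_law hp, ← sum_marg_mul _ (fun ω : (Fin n → (S₁ × S₂) × Z) × (Fin n → Y) =>
      ((ω.1 i).1, (c.dec₁ ω.2 i, c.dec₂ ω.2 i))) fun q => d q.1 q.2]
    rw [Fintype.sum_prod_type]
  simp only [h, Code.testMass, Finset.sum_mul, Finset.mul_sum, one_div]
  rw [Finset.sum_comm (s := (univ : Finset (Fin n)))]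
  refine Finset.sum_congr rfl fun s _ => ?_
  rw [Finset.sum_comm (s := (univ : Finset (Fin n)))]
  simp only [mul_assoc]

end Distortion

/-! ### Reduction to a finite conditioning variable -/

section Truncation

variable {S₁ S₂ Z : Type*}

/-- The law of `(S₁, S₂, V)`, where `V = Z` if `Z ∈ F`, and `V = S₁` otherwise. -/
def truncMass (p : S₁ × S₂ → ℝ) (ρ : (S₁ × S₂) × Z → ℝ) (F : Finset Z) :
    (S₁ × S₂) × (F ⊕ S₁) → ℝ :=
  fun a => Sum.elim (fun z : F => ρ (a.1, (z : Z)))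
    (fun s => if s = a.1.1 then p a.1 - ∑ z ∈ F, ρ (a.1, z) else 0) a.2

variable {p : S₁ × S₂ → ℝ} {ρ : (S₁ × S₂) × Z → ℝ} {F : Finset Z}

lemma truncMass_nonneg (hρ : ∀ a, 0 ≤ ρ a) (hF : ∀ s, ∑ z ∈ F, ρ (s, z) ≤ p s) (a) :
    0 ≤ truncMass p ρ F a := by
  obtain ⟨s, z | t⟩ := a
  · exact hρ _
  · simp only [truncMass, Sum.elim_inr]
    split_ifs
    · exact sub_nonneg.2 (hF s)
    · exact le_rfl

variable [Fintype S₁] [Fintype S₂]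

lemma marg_truncMass_source (s : S₁ × S₂) :
    marg (truncMass p ρ F) (fun a => a.1) s = p s := by
  have h : marg (truncMass p ρ F) (fun a => a.1) s = ∑ z, truncMass p ρ F (s, z) := by
    rw [marg, Fintype.sum_prod_type, Finset.sum_eq_single s]
    · simp
    · intro s' _ hs'
      simp [hs']
    · simp
  rw [h, Fintype.sum_sum_type]
  simp only [truncMass, Sum.elim_inl, Sum.elim_inr, Finset.sum_ite_eq', Finset.mem_univ, if_true]
  rw [Finset.sum_coe_sort F fun z => ρ (s, z)]
  ring

lemma sum_truncMass (hp : ∑ s, p s = 1) : ∑ a, truncMass p ρ F a = 1 := by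
  rw [← sum_marg _ fun a : (S₁ × S₂) × (F ⊕ S₁) => a.1]
  simp only [marg_truncMass_source, hp]

lemma marg_pair₁ {Z' : Type*} [Fintype Z'] (r : (S₁ × S₂) × Z' → ℝ) (a : S₁) (c : Z') :
    marg r (fun q => (q.1.1, q.2)) (a, c) = ∑ b, r ((a, b), c) := by
  rw [← sum_marg_triple_mid r _ fun q => q.1.2]
  refine Finset.sum_congr rfl fun b _ => ?_
  rw [marg, Finset.sum_eq_single ((a, b), c)]
  · simp
  · intro q _ hq
    rw [if_neg]
    rintro ⟨rfl, rfl, rfl⟩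
    exact hq rfl
  · simp

lemma marg_pair₂ {Z' : Type*} [Fintype Z'] (r : (S₁ × S₂) × Z' → ℝ) (b : S₂) (c : Z') :
    marg r (fun q => (q.1.2, q.2)) (b, c) = ∑ a, r ((a, b), c) := by
  rw [← sum_marg_prodMk_left r fun q => q.1.1]
  refine Finset.sum_congr rfl fun a _ => ?_
  rw [marg, Finset.sum_eq_single ((a, b), c)]
  · simp
  · intro q _ hq
    rw [if_neg]
    rintro ⟨rfl, rfl, rfl⟩
    exact hq rfl
  · simp

lemma condIndep_truncMass
    (h : ∀ a b z, ρ ((a, b), z) * ∑ a, ∑ b, ρ ((a, b), z) =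
      (∑ b, ρ ((a, b), z)) * ∑ a, ρ ((a, b), z)) :
    CondIndep (truncMass p ρ F) (fun a => a.1.1) (fun a => a.1.2) (fun a => a.2) := by
  intro a b c
  have h1 : marg (truncMass p ρ F) (fun q => (q.1.1, q.1.2, q.2)) (a, b, c) =
      truncMass p ρ F ((a, b), c) := by
    rw [marg, Finset.sum_eq_single ((a, b), c)]
    · simp
    · intro q _ hq
      rw [if_neg]
      rintro ⟨rfl, rfl, rfl⟩
      exact hq rfl
    · simp
  have h2 : marg (truncMass p ρ F) (fun q => q.2) c =
      ∑ a, ∑ b, truncMass p ρ F ((a, b), c) := by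
    rw [← sum_marg_prodMk_left _ fun q => q.1.1]
    exact Finset.sum_congr rfl fun a _ => marg_pair₁ _ _ _
  rw [h1, h2, marg_pair₁, marg_pair₂]
  obtain z | s := c
  · exact h a b z
  · simp only [truncMass, Sum.elim_inr]
    by_cases hs : s = a
    · subst hs
      simp only [if_true]
      rw [Finset.sum_eq_single s, Finset.sum_eq_single s]
      · simp only [if_true]; ring
      · intro a' _ ha'
        rw [if_neg (Ne.symm ha')]
      · simp
      · intro a' _ ha'
        simp [Ne.symm ha']
      · simp
    · simp [hs]

end Truncation

/-! ### Approximate solutions and their limit -/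

section Limit

variable {S₁ S₂ X₁ X₂ Y T₁ T₂ Z : Type*} [Fintype S₁] [Fintype S₂] [Fintype X₁] [Fintype X₂]
  [Fintype Y] [Fintype T₁] [Fintype T₂]

/-- Test channels `f₁`, `f₂`, `f` (as joint mass functions) and a rate vector `v` that satisfy the
outer bound on the finite set `F` of values of the conditioning variable, with distortions
`D₁ + ε` and `D₂ + ε`. -/
structure IsApproxSolution (p : S₁ × S₂ → ℝ) (ρ : (S₁ × S₂) × Z → ℝ) (w : X₁ × X₂ → Y → ℝ)
    (d₁ : S₁ → T₁ → ℝ) (d₂ : S₂ → T₂ → ℝ) (C D₁ D₂ ε : ℝ) (F : Finset Z)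
    (f₁ : Z → S₁ → T₁ → ℝ) (f₂ : Z → S₂ → T₂ → ℝ) (f : S₁ × S₂ → T₁ × T₂ → ℝ)
    (v : ℝ × ℝ × ℝ × (X₁ × X₂ → ℝ)) : Prop where
  mem : v ∈ rateRegion w
  mem₁ : f₁ ∈ Set.Icc 0 1
  mem₂ : f₂ ∈ Set.Icc 0 1
  memJoint : f ∈ Set.Icc 0 1
  sum₁ : ∀ z ∈ F, ∀ s, ∑ t, f₁ z s t = ∑ b, ρ ((s, b), z)
  sum₂ : ∀ z ∈ F, ∀ s, ∑ t, f₂ z s t = ∑ a, ρ ((a, s), z)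
  sum : ∀ s, ∑ t, f s t = p s
  dist₁ : ∀ F₀ ⊆ F, ∑ z ∈ F₀, ∑ s, ∑ t, f₁ z s t * (d₁ s t + C) ≤ D₁ + ε + C
  dist₂ : ∀ F₀ ⊆ F, ∑ z ∈ F₀, ∑ s, ∑ t, f₂ z s t * (d₂ s t + C) ≤ D₂ + ε + C
  distJoint₁ : ∑ s, ∑ t, f s t * d₁ s.1 t.1 ≤ D₁ + ε
  distJoint₂ : ∑ s, ∑ t, f s t * d₂ s.2 t.2 ≤ D₂ + ε
  rate₁ : ∀ F₀ ⊆ F, ∑ z ∈ F₀, massInfo (f₁ z) ≤ v.1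
  rate₂ : ∀ F₀ ⊆ F, ∑ z ∈ F₀, massInfo (f₂ z) ≤ v.2.1
  rate : ∀ F₀ ⊆ F, ∑ z ∈ F₀, massInfo (f₁ z) + ∑ z ∈ F₀, massInfo (f₂ z) ≤ v.2.2.1
  rateJoint : massInfo f ≤ inputInfo w v.2.2.2

/-- A sum over values in `F` is at most the sum over all values of the truncated variable. -/
lemma sum_dite_le {A : Type*} [Fintype A] {F F₀ : Finset Z} (hF₀ : F₀ ⊆ F) {g : F ⊕ A → ℝ}
    (hg : ∀ a, 0 ≤ g a) {h : Z → ℝ} (hh : ∀ z (hz : z ∈ F), h z = g (Sum.inl ⟨z, hz⟩)) :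
    ∑ z ∈ F₀, h z ≤ ∑ a, g a := by
  rw [Fintype.sum_sum_type]
  have h1 : ∑ z ∈ F₀, h z ≤ ∑ z ∈ F, h z :=
    Finset.sum_le_sum_of_subset_of_nonneg hF₀ fun z hz _ => by rw [hh z hz]; exact hg _
  have h2 : ∑ z ∈ F, h z = ∑ z : F, g (Sum.inl z) := by
    rw [← Finset.sum_coe_sort F h]
    exact Finset.sum_congr rfl fun z _ => hh z z.2
  have h3 : 0 ≤ ∑ a : A, g (Sum.inr a) := Finset.sum_nonneg fun a _ => hg _
  linarith

lemma le_sum_sum_sum {A B E : Type*} [Fintype A] [Fintype B] [Fintype E] {f : A → B → E → ℝ}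
    (hf : ∀ a b e, 0 ≤ f a b e) (a : A) (b : B) (e : E) : f a b e ≤ ∑ a, ∑ b, ∑ e, f a b e :=
  (Finset.single_le_sum (f := fun e => f a b e) (fun e _ => hf a b e) (Finset.mem_univ e)).trans <|
    (Finset.single_le_sum (f := fun b => ∑ e, f a b e)
      (fun b _ => Finset.sum_nonneg fun e _ => hf a b e) (Finset.mem_univ b)).trans <|
    Finset.single_le_sum (f := fun a => ∑ b, ∑ e, f a b e)
      (fun a _ => Finset.sum_nonneg fun b _ => Finset.sum_nonneg fun e _ => hf a b e)
      (Finset.mem_univ a)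

lemma exists_isApproxSolution {p : PMF (S₁ × S₂)} {W : X₁ × X₂ → PMF Y} {d₁ : S₁ → T₁ → ℝ}
    {d₂ : S₂ → T₂ → ℝ} {C D₁ D₂ : ℝ} (hC₁ : ∀ s t, 0 ≤ d₁ s t + C) (hC₂ : ∀ s t, 0 ≤ d₂ s t + C)
    (hD : Achievable p W d₁ d₂ D₁ D₂) {ρ : (S₁ × S₂) × Z → ℝ} (hρ : ∀ a, 0 ≤ ρ a)
    (hle : ∀ (F : Finset Z) s, ∑ z ∈ F, ρ (s, z) ≤ (p s).toReal)
    (hind : ∀ a b z, ρ ((a, b), z) * ∑ a, ∑ b, ρ ((a, b), z) =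
      (∑ b, ρ ((a, b), z)) * ∑ a, ρ ((a, b), z))
    (F : Finset Z) {ε : ℝ} (hε : 0 < ε) :
    ∃ f₁ f₂ f v, IsApproxSolution (fun s => (p s).toReal) ρ (fun x y => (W x y).toReal) d₁ d₂ C
      D₁ D₂ ε F f₁ f₂ f v := by
  obtain ⟨N, hN⟩ := hD ε hε
  obtain ⟨c, hc₁, hc₂⟩ := hN (N + 1) (Nat.le_succ N)
  obtain ⟨s₀, -⟩ := p.support_nonempty
  have : Nonempty X₁ := ⟨c.enc₁ (fun _ => s₀.1) 0⟩
  have : Nonempty X₂ := ⟨c.enc₂ (fun _ => s₀.2) 0⟩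
  set w : X₁ × X₂ → Y → ℝ := fun x y => (W x y).toReal with hwdef
  set r := truncMass (fun s => (p s).toReal) ρ F with hrdef
  have hw0 : ∀ a y, 0 ≤ w a y := fun a y => ENNReal.toReal_nonneg
  have hw : ∀ a, ∑ y, w a y = 1 := fun a => sum_toReal (W a)
  have hr : ∀ a, 0 ≤ r a := truncMass_nonneg hρ (hle F)
  have hr1 : ∑ a, r a = 1 := sum_truncMass (sum_toReal p)
  have hrp : ∀ s, marg r (fun a => a.1) s = (p s).toReal := fun s => marg_truncMass_source s
  have hn : 0 < N + 1 := Nat.succ_pos N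
  obtain ⟨v, hv, hv1, hv2, hv3, hv4⟩ :=
    c.exists_rateVec hn hr hr1 (condIndep_truncMass hind) hw0 hw
  have hμ : ∀ t, 0 ≤ blockMass r w c.input t := blockMass_nonneg hr hw0
  have hn₁ : ∀ z s t, 0 ≤ c.testMass₁ r w z s t := fun z s t =>
    Finset.sum_nonneg fun i _ => mul_nonneg (by positivity) (marg_nonneg hμ _ _)
  have hn₂ : ∀ z s t, 0 ≤ c.testMass₂ r w z s t := fun z s t =>
    Finset.sum_nonneg fun i _ => mul_nonneg (by positivity) (marg_nonneg hμ _ _)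
  have hs₁ : ∑ z, ∑ s, ∑ t, c.testMass₁ r w z s t = 1 := by
    simp only [c.sum_testMass₁ hn hr1 hw]
    rw [← hr1, ← sum_marg r fun a => (a.1.1, a.2), Fintype.sum_prod_type_right]
  have hs₂ : ∑ z, ∑ s, ∑ t, c.testMass₂ r w z s t = 1 := by
    simp only [c.sum_testMass₂ hn hr1 hw]
    rw [← hr1, ← sum_marg r fun a => (a.1.2, a.2), Fintype.sum_prod_type_right]
  have hn₀ : ∀ s t, 0 ≤ c.testMass r w s t := fun s t =>
    Finset.sum_nonneg fun i _ => mul_nonneg (by positivity) (marg_nonneg hμ _ _)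
  have hle₁ : ∀ z s t, c.testMass₁ r w z s t ≤ 1 := fun z s t =>
    (le_sum_sum_sum hn₁ z s t).trans hs₁.le
  have hle₂ : ∀ z s t, c.testMass₂ r w z s t ≤ 1 := fun z s t =>
    (le_sum_sum_sum hn₂ z s t).trans hs₂.le
  let f₁ : Z → S₁ → T₁ → ℝ := fun z =>
    if hz : z ∈ F then c.testMass₁ r w (Sum.inl ⟨z, hz⟩) else fun _ _ => 0
  let f₂ : Z → S₂ → T₂ → ℝ := fun z =>
    if hz : z ∈ F then c.testMass₂ r w (Sum.inl ⟨z, hz⟩) else fun _ _ => 0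
  have hf₁ : ∀ z (hz : z ∈ F), f₁ z = c.testMass₁ r w (Sum.inl ⟨z, hz⟩) := fun z hz => dif_pos hz
  have hf₂ : ∀ z (hz : z ∈ F), f₂ z = c.testMass₂ r w (Sum.inl ⟨z, hz⟩) := fun z hz => dif_pos hz
  have hI₁ : ∀ F₀ ⊆ F, ∑ z ∈ F₀, massInfo (f₁ z) ≤ ∑ z, massInfo (c.testMass₁ r w z) :=
    fun F₀ hF₀ => sum_dite_le hF₀ (fun z => massInfo_nonneg (hn₁ z))
      fun z hz => by rw [hf₁ z hz]
  have hI₂ : ∀ F₀ ⊆ F, ∑ z ∈ F₀, massInfo (f₂ z) ≤ ∑ z, massInfo (c.testMass₂ r w z) :=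
    fun F₀ hF₀ => sum_dite_le hF₀ (fun z => massInfo_nonneg (hn₂ z))
      fun z hz => by rw [hf₂ z hz]
  refine ⟨f₁, f₂, c.testMass r w, v, ?_⟩
  constructor
  · exact hv
  · refine ⟨fun z s t => ?_, fun z s t => ?_⟩ <;> by_cases hz : z ∈ F
    · rw [hf₁ z hz]; exact hn₁ _ _ _
    · simp [f₁, hz]
    · rw [hf₁ z hz]; exact hle₁ _ _ _
    · simp [f₁, hz]
  · refine ⟨fun z s t => ?_, fun z s t => ?_⟩ <;> by_cases hz : z ∈ F
    · rw [hf₂ z hz]; exact hn₂ _ _ _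
    · simp [f₂, hz]
    · rw [hf₂ z hz]; exact hle₂ _ _ _
    · simp [f₂, hz]
  · refine ⟨hn₀, fun s t => ?_⟩
    refine (Finset.single_le_sum (fun t _ => hn₀ s t) (Finset.mem_univ t)).trans ?_
    rw [c.sum_testMass hn hr1 hw, hrp]
    exact ENNReal.toReal_le_of_le_ofReal zero_le_one (by simpa using p.coe_le_one s)
  · intro z hz s
    rw [hf₁ z hz, c.sum_testMass₁ hn hr1 hw, marg_pair₁]
    rfl
  · intro z hz s
    rw [hf₂ z hz, c.sum_testMass₂ hn hr1 hw, marg_pair₂]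
    rfl
  · intro s
    rw [c.sum_testMass hn hr1 hw, hrp]
  · intro F₀ hF₀
    refine (sum_dite_le hF₀ (g := fun z => ∑ s, ∑ t, c.testMass₁ r w z s t * (d₁ s t + C))
      (fun z => Finset.sum_nonneg fun s _ => Finset.sum_nonneg fun t _ =>
        mul_nonneg (hn₁ z s t) (hC₁ s t)) fun z hz => by rw [hf₁ z hz]).trans ?_
    simp only [mul_add, Finset.sum_add_distrib, ← Finset.sum_mul]
    rw [hs₁, c.sum_testMass₁_mul hrp]
    linarith
  · intro F₀ hF₀
    refine (sum_dite_le hF₀ (g := fun z => ∑ s, ∑ t, c.testMass₂ r w z s t * (d₂ s t + C))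
      (fun z => Finset.sum_nonneg fun s _ => Finset.sum_nonneg fun t _ =>
        mul_nonneg (hn₂ z s t) (hC₂ s t)) fun z hz => by rw [hf₂ z hz]).trans ?_
    simp only [mul_add, Finset.sum_add_distrib, ← Finset.sum_mul]
    rw [hs₂, c.sum_testMass₂_mul hrp]
    linarith
  · rw [c.sum_testMass_mul hrp fun s t => d₁ s.1 t.1]
    exact hc₁
  · rw [c.sum_testMass_mul hrp fun s t => d₂ s.2 t.2]
    exact hc₂
  · exact fun F₀ hF₀ => (hI₁ F₀ hF₀).trans hv1
  · exact fun F₀ hF₀ => (hI₂ F₀ hF₀).trans hv2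
  · exact fun F₀ hF₀ => (add_le_add (hI₁ F₀ hF₀) (hI₂ F₀ hF₀)).trans hv3
  · exact hv4

/-- A cluster point of approximate solutions is an exact solution. -/
lemma exists_solution {p : S₁ × S₂ → ℝ} {ρ : (S₁ × S₂) × Z → ℝ} {w : X₁ × X₂ → Y → ℝ}
    {d₁ : S₁ → T₁ → ℝ} {d₂ : S₂ → T₂ → ℝ} {C D₁ D₂ : ℝ}
    (h : ∀ (F : Finset Z) (ε : ℝ), 0 < ε → ∃ f₁ f₂ f v,
      IsApproxSolution p ρ w d₁ d₂ C D₁ D₂ ε F f₁ f₂ f v) :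
    ∃ f₁ f₂ f v, ∀ F : Finset Z, IsApproxSolution p ρ w d₁ d₂ C D₁ D₂ 0 F f₁ f₂ f v := by
  have h' : ∀ q : Finset Z × ℕ, ∃ u : (Z → S₁ → T₁ → ℝ) × (Z → S₂ → T₂ → ℝ) ×
      (S₁ × S₂ → T₁ × T₂ → ℝ) × (ℝ × ℝ × ℝ × (X₁ × X₂ → ℝ)),
      IsApproxSolution p ρ w d₁ d₂ C D₁ D₂ (1 / ((q.2 : ℝ) + 1)) q.1 u.1 u.2.1 u.2.2.1
        u.2.2.2 := by
    intro q
    obtain ⟨f₁, f₂, f, v, hq⟩ := h q.1 (1 / ((q.2 : ℝ) + 1)) (by positivity)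
    exact ⟨(f₁, f₂, f, v), hq⟩
  choose u hu using h'
  let 𝒰 : Ultrafilter (Finset Z × ℕ) := Ultrafilter.of atTop
  have h𝒰 : (𝒰 : Filter (Finset Z × ℕ)) ≤ atTop := Ultrafilter.of_le atTop
  have hcomp : IsCompact (Set.Icc (0 : Z → S₁ → T₁ → ℝ) 1 ×ˢ Set.Icc (0 : Z → S₂ → T₂ → ℝ) 1 ×ˢ
      Set.Icc (0 : S₁ × S₂ → T₁ × T₂ → ℝ) 1 ×ˢ rateRegion w) :=
    isCompact_Icc.prod (isCompact_Icc.prod (isCompact_Icc.prod (isCompact_rateRegion w)))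
  obtain ⟨l, ⟨hl₁, hl₂, hl₃, hl₄⟩, hlim⟩ := hcomp.ultrafilter_le_nhds (𝒰.map u) (by
    rw [Ultrafilter.coe_map, Filter.le_principal_iff]
    exact Filter.mem_map.2 (Filter.univ_mem'
      fun q => ⟨(hu q).mem₁, (hu q).mem₂, (hu q).memJoint, (hu q).mem⟩))
  have hlim : Tendsto u 𝒰 (𝓝 l) := hlim
  have hε : Tendsto (fun q : Finset Z × ℕ => 1 / ((q.2 : ℝ) + 1)) 𝒰 (𝓝 0) := by
    have h1 : Tendsto (fun q : Finset Z × ℕ => q.2) atTop atTop := by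
      rw [← prod_atTop_atTop_eq]
      exact tendsto_snd
    exact tendsto_one_div_add_atTop_nhds_zero_nat.comp (h1.mono_left h𝒰)
  have hF : ∀ F : Finset Z, ∀ᶠ q in (𝒰 : Filter (Finset Z × ℕ)), F ⊆ q.1 := by
    intro F
    refine h𝒰 ?_
    filter_upwards [eventually_ge_atTop (F, 0)] with q hq using hq.1
  have T : ∀ G : (Z → S₁ → T₁ → ℝ) × (Z → S₂ → T₂ → ℝ) × (S₁ × S₂ → T₁ × T₂ → ℝ) ×
      (ℝ × ℝ × ℝ × (X₁ × X₂ → ℝ)) → ℝ, Continuous G →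
      Tendsto (fun q => G (u q)) 𝒰 (𝓝 (G l)) := fun G hG => (hG.tendsto l).comp hlim
  have hm₁ := continuous_massInfo (A := S₁) (B := T₁)
  have hm₂ := continuous_massInfo (A := S₂) (B := T₂)
  have hm := continuous_massInfo (A := S₁ × S₂) (B := T₁ × T₂)
  have hI := continuous_inputInfo w
  have hDε : ∀ D : ℝ, Tendsto (fun q : Finset Z × ℕ => D + 1 / ((q.2 : ℝ) + 1)) 𝒰
      (𝓝 (D + 0)) := fun D => hε.const_add D
  refine ⟨l.1, l.2.1, l.2.2.1, l.2.2.2, fun F => ?_⟩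
  constructor
  · exact hl₄
  · exact hl₁
  · exact hl₂
  · exact hl₃
  · intro z _ s
    refine tendsto_nhds_unique_of_eventuallyEq (T (fun u => ∑ t, u.1 z s t) (by fun_prop))
      tendsto_const_nhds ?_
    filter_upwards [hF {z}] with q hq using (hu q).sum₁ z (hq (Finset.mem_singleton_self z)) s
  · intro z _ s
    refine tendsto_nhds_unique_of_eventuallyEq (T (fun u => ∑ t, u.2.1 z s t) (by fun_prop))
      tendsto_const_nhds ?_
    filter_upwards [hF {z}] with q hq using (hu q).sum₂ z (hq (Finset.mem_singleton_self z)) s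
  · intro s
    exact tendsto_nhds_unique_of_eventuallyEq (T (fun u => ∑ t, u.2.2.1 s t) (by fun_prop))
      tendsto_const_nhds (Eventually.of_forall fun q => (hu q).sum s)
  · intro F₀ _
    refine le_of_tendsto_of_tendsto (T (fun u => ∑ z ∈ F₀, ∑ s, ∑ t, u.1 z s t * (d₁ s t + C))
      (by fun_prop)) ((hDε D₁).add_const C) ?_
    filter_upwards [hF F₀] with q hq using (hu q).dist₁ F₀ hq
  · intro F₀ _
    refine le_of_tendsto_of_tendsto (T (fun u => ∑ z ∈ F₀, ∑ s, ∑ t, u.2.1 z s t * (d₂ s t + C))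
      (by fun_prop)) ((hDε D₂).add_const C) ?_
    filter_upwards [hF F₀] with q hq using (hu q).dist₂ F₀ hq
  · exact le_of_tendsto_of_tendsto (T (fun u => ∑ s, ∑ t, u.2.2.1 s t * d₁ s.1 t.1)
      (by fun_prop)) (hDε D₁) (Eventually.of_forall fun q => (hu q).distJoint₁)
  · exact le_of_tendsto_of_tendsto (T (fun u => ∑ s, ∑ t, u.2.2.1 s t * d₂ s.2 t.2)
      (by fun_prop)) (hDε D₂) (Eventually.of_forall fun q => (hu q).distJoint₂)
  · intro F₀ _
    refine le_of_tendsto_of_tendsto (T (fun u => ∑ z ∈ F₀, massInfo (u.1 z)) (by fun_prop))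
      (T (fun u => u.2.2.2.1) (by fun_prop)) ?_
    filter_upwards [hF F₀] with q hq using (hu q).rate₁ F₀ hq
  · intro F₀ _
    refine le_of_tendsto_of_tendsto (T (fun u => ∑ z ∈ F₀, massInfo (u.2.1 z)) (by fun_prop))
      (T (fun u => u.2.2.2.2.1) (by fun_prop)) ?_
    filter_upwards [hF F₀] with q hq using (hu q).rate₂ F₀ hq
  · intro F₀ _
    refine le_of_tendsto_of_tendsto
      (T (fun u => ∑ z ∈ F₀, massInfo (u.1 z) + ∑ z ∈ F₀, massInfo (u.2.1 z)) (by fun_prop))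
      (T (fun u => u.2.2.2.2.2.1) (by fun_prop)) ?_
    filter_upwards [hF F₀] with q hq using (hu q).rate F₀ hq
  · exact le_of_tendsto_of_tendsto (T (fun u => massInfo u.2.2.1) (by fun_prop))
      (T (fun u => inputInfo w u.2.2.2.2.2.2) (by fun_prop))
      (Eventually.of_forall fun q => (hu q).rateJoint)

end Limit

/-! ### Realisation of rate vectors -/

section Realisation

variable {X₁ X₂ Y : Type*} [Fintype X₁] [Fintype X₂] [Fintype Y]

lemma exists_pmf_of_mem_rateRegion {W : X₁ × X₂ → PMF Y} {v}
    (hv : v ∈ rateRegion fun x y => (W x y).toReal) :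
    ∃ (k : ℕ) (pQ : PMF ((X₁ × X₂) × Fin k)),
      IsMarkovChain pQ (fun ω => ω.1.1) (fun ω => ω.2) (fun ω => ω.1.2) ∧
      condMutualInfo (channelLaw pQ W) (fun ω => ω.1.1.1) (fun ω => ω.2)
        (fun ω => (ω.1.1.2, ω.1.2)) = v.1 ∧
      condMutualInfo (channelLaw pQ W) (fun ω => ω.1.1.2) (fun ω => ω.2)
        (fun ω => (ω.1.1.1, ω.1.2)) = v.2.1 ∧
      condMutualInfo (channelLaw pQ W) (fun ω => ω.1.1) (fun ω => ω.2) (fun ω => ω.1.2) =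
        v.2.2.1 ∧
      mutualInfo (channelLaw pQ W) (fun ω => ω.1.1) (fun ω => ω.2) =
        inputInfo (fun x y => (W x y).toReal) v.2.2.2 := by
  obtain ⟨k, q, p₁, p₂, hq, hq1, hp₁, hp₂, rfl⟩ := exists_of_mem_rateRegion hv
  let M : (X₁ × X₂) × Fin k → ℝ := fun ω => q ω.2 * (p₁ ω.2 ω.1.1 * p₂ ω.2 ω.1.2)
  have hM : ∀ ω, 0 ≤ M ω := fun ω =>
    mul_nonneg (hq _) (mul_nonneg ((hp₁ _).1 _) ((hp₂ _).1 _))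
  have hMsum : ∑ ω, M ω = 1 := by
    simp only [M, Fintype.sum_prod_type_right, ← Finset.mul_sum, ← Finset.sum_mul, (hp₁ _).2,
      (hp₂ _).2, mul_one, hq1]
  let pQ : PMF ((X₁ × X₂) × Fin k) := PMF.ofFintype (fun ω => ENNReal.ofReal (M ω)) (by
    rw [← ENNReal.ofReal_sum_of_nonneg fun ω _ => hM ω, hMsum, ENNReal.ofReal_one])
  have hpQ : ∀ ω, (pQ ω).toReal = M ω := fun ω => by
    rw [PMF.ofFintype_apply, ENNReal.toReal_ofReal (hM ω)]
  have hch : ∀ ω y, (channelLaw pQ W (ω, y)).toReal = M ω * (W ω.1 y).toReal := fun ω y => by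
    rw [channelLaw, joint_apply, ENNReal.toReal_mul, hpQ]
  refine ⟨k, pQ, ?_, ?_, ?_, ?_, ?_⟩
  · intro a c b
    have h3 : ∀ a b, prob pQ (fun ω => (ω.1.1, ω.1.2, ω.2)) (a, b, c) = M ((a, b), c) :=
      fun a b => by rw [prob_of_fiber _ (ω := ((a, b), c)) (by grind), hpQ]
    have h1 : ∀ a, prob pQ (fun ω => (ω.1.1, ω.2)) (a, c) = ∑ b, M ((a, b), c) := fun a => by
      rw [← sum_prob_mid pQ _ fun ω => ω.1.2]
      exact Finset.sum_congr rfl fun b _ => h3 a b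
    have h2 : prob pQ (fun ω => (ω.1.2, ω.2)) (b, c) = ∑ a, M ((a, b), c) := by
      rw [← sum_prob_left pQ fun ω => ω.1.1]
      exact Finset.sum_congr rfl fun a _ => h3 a b
    have h0 : prob pQ (fun ω => ω.2) c = ∑ a, ∑ b, M ((a, b), c) := by
      rw [← sum_prob_left pQ fun ω => ω.1.1]
      exact Finset.sum_congr rfl fun a _ => h1 a
    rw [h3, h0, h1, h2]
    simp only [M, ← Finset.mul_sum, ← Finset.sum_mul, (hp₁ _).2, (hp₂ _).2]
    ring
  · rw [condMutualInfo_eq_tsum, tsum_fintype, Fintype.sum_prod_type_right]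
    simp only [Prod.fst_sum, rateVec]
    refine Finset.sum_congr rfl fun c _ => Finset.sum_congr rfl fun x₂ _ => ?_
    congr 1
    funext x₁ y
    rw [prob_of_fiber _ (ω := (((x₁, x₂), c), y)) (by grind), hch]
  · rw [condMutualInfo_eq_tsum, tsum_fintype, Fintype.sum_prod_type_right]
    simp only [Prod.fst_sum, Prod.snd_sum, rateVec]
    refine Finset.sum_congr rfl fun c _ => Finset.sum_congr rfl fun x₁ _ => ?_
    congr 1
    funext x₂ y
    rw [prob_of_fiber _ (ω := (((x₁, x₂), c), y)) (by grind), hch]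
  · rw [condMutualInfo_eq_tsum, tsum_fintype]
    simp only [Prod.fst_sum, Prod.snd_sum, rateVec]
    refine Finset.sum_congr rfl fun c _ => ?_
    rw [inputInfo]
    congr 1
    funext x y
    rw [prob_of_fiber _ (ω := ((x, c), y)) (by grind), hch]
  · rw [mutualInfo_eq, inputInfo]
    simp only [Prod.snd_sum, rateVec]
    congr 1
    funext x y
    rw [← sum_prob_right _ (fun ω : ((X₁ × X₂) × Fin k) × Y => (ω.1.1, ω.2))
      fun ω => ω.1.2, Finset.sum_apply,
      Finset.sum_mul]
    refine Finset.sum_congr rfl fun c _ => ?_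
    rw [prob_of_fiber _ (ω := ((x, c), y)) (by grind), hch]

end Realisation

end MAC

end

open MAC

theorem mainTheorem5 {S₁ S₂ X₁ X₂ Y T₁ T₂ : Type*}
    [Fintype S₁] [Fintype S₂] [Fintype X₁] [Fintype X₂] [Fintype Y] [Fintype T₁] [Fintype T₂]
    (p : PMF (S₁ × S₂)) (W : X₁ × X₂ → PMF Y)
    (d₁ : S₁ → T₁ → ℝ) (d₂ : S₂ → T₂ → ℝ) (D₁ D₂ : ℝ)
    (hD : MAC.Achievable p W d₁ d₂ D₁ D₂)
    {Z : Type*} (pZ : PMF ((S₁ × S₂) × Z)) (hp : pZ.map (fun ω => ω.1) = p)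
    (hZ : MAC.IsMarkovChain pZ (fun ω => ω.1.1) (fun ω => ω.2) (fun ω => ω.1.2)) :
    ∃ (m : ℕ) (pQ : PMF ((X₁ × X₂) × Fin m)),
      MAC.IsMarkovChain pQ (fun ω => ω.1.1) (fun ω => ω.2) (fun ω => ω.1.2) ∧
      MAC.condRateDistortion (pZ.map fun ω => (ω.1.1, ω.2)) d₁ D₁ ≤
        ((MAC.condMutualInfo (MAC.channelLaw pQ W) (fun ω => ω.1.1.1) (fun ω => ω.2)
          (fun ω => (ω.1.1.2, ω.1.2)) : ℝ) : EReal) ∧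
      MAC.condRateDistortion (pZ.map fun ω => (ω.1.2, ω.2)) d₂ D₂ ≤
        ((MAC.condMutualInfo (MAC.channelLaw pQ W) (fun ω => ω.1.1.2) (fun ω => ω.2)
          (fun ω => (ω.1.1.1, ω.1.2)) : ℝ) : EReal) ∧
      MAC.condRateDistortion (pZ.map fun ω => (ω.1.1, ω.2)) d₁ D₁ +
          MAC.condRateDistortion (pZ.map fun ω => (ω.1.2, ω.2)) d₂ D₂ ≤
        ((MAC.condMutualInfo (MAC.channelLaw pQ W) (fun ω => ω.1.1) (fun ω => ω.2)
          (fun ω => ω.1.2) : ℝ) : EReal) ∧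
      MAC.jointRateDistortion p d₁ d₂ D₁ D₂ ≤
        ((MAC.mutualInfo (MAC.channelLaw pQ W) (fun ω => ω.1.1) (fun ω => ω.2) : ℝ) : EReal) := by
  classical
  obtain ⟨C, hC₁, hC₂⟩ : ∃ C : ℝ, (∀ s t, 0 ≤ d₁ s t + C) ∧ ∀ s t, 0 ≤ d₂ s t + C := by
    obtain ⟨C₁, h₁⟩ := (Set.finite_range fun a : S₁ × T₁ => -d₁ a.1 a.2).bddAbove
    obtain ⟨C₂, h₂⟩ := (Set.finite_range fun a : S₂ × T₂ => -d₂ a.1 a.2).bddAbove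
    refine ⟨max C₁ C₂, fun s t => ?_, fun s t => ?_⟩
    · have : -d₁ s t ≤ C₁ := h₁ ⟨(s, t), rfl⟩
      linarith [le_max_left C₁ C₂]
    · have : -d₂ s t ≤ C₂ := h₂ ⟨(s, t), rfl⟩
      linarith [le_max_right C₁ C₂]
  let ρ : (S₁ × S₂) × Z → ℝ := fun a => (pZ a).toReal
  have h3 : ∀ a b z, prob pZ (fun ω => (ω.1.1, ω.1.2, ω.2)) (a, b, z) = ρ ((a, b), z) :=
    fun a b z => prob_of_fiber _ (by grind)
  have hP₁ : ∀ a z, prob pZ (fun ω => (ω.1.1, ω.2)) (a, z) = ∑ b, ρ ((a, b), z) := fun a z => by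
    rw [← sum_prob_mid pZ _ fun ω => ω.1.2]
    exact Finset.sum_congr rfl fun b _ => h3 a b z
  have hP₂ : ∀ b z, prob pZ (fun ω => (ω.1.2, ω.2)) (b, z) = ∑ a, ρ ((a, b), z) := fun b z => by
    rw [← sum_prob_left pZ fun ω => ω.1.1]
    exact Finset.sum_congr rfl fun a _ => h3 a b z
  have hP : ∀ z, prob pZ (fun ω => ω.2) z = ∑ a, ∑ b, ρ ((a, b), z) := fun z => by
    rw [← sum_prob_left pZ fun ω => ω.1.1]
    exact Finset.sum_congr rfl fun a _ => hP₁ a z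
  have hle : ∀ (F : Finset Z) s, ∑ z ∈ F, ρ (s, z) ≤ (p s).toReal := by
    intro F s
    have h1 := prob_eq_tsum pZ (fun ω => ω.1) s
    rw [prob, hp] at h1
    rw [h1]
    have h2 := (summable_ite_toReal pZ fun ω => ω.1 = s).sum_le_tsum
      (F.map ⟨fun z => (s, z), Prod.mk_right_injective s⟩)
      (fun ω _ => by split_ifs <;> simp)
    simpa [ρ] using h2
  have hind : ∀ a b z, ρ ((a, b), z) * ∑ a, ∑ b, ρ ((a, b), z) =
      (∑ b, ρ ((a, b), z)) * ∑ a, ρ ((a, b), z) := fun a b z => by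
    rw [← h3, ← hP, ← hP₁, ← hP₂]
    exact hZ a z b
  obtain ⟨f₁, f₂, f, v, hsol⟩ := exists_solution fun F ε hε =>
    exists_isApproxSolution hC₁ hC₂ hD (ρ := ρ) (fun a => ENNReal.toReal_nonneg) hle hind F hε
  obtain ⟨k, pQ, hQ, e1, e2, e3, e4⟩ := exists_pmf_of_mem_rateRegion (hsol ∅).mem
  have hn₁ : ∀ z s t, 0 ≤ f₁ z s t := fun z s t => (hsol ∅).mem₁.1 z s t
  have hn₂ : ∀ z s t, 0 ≤ f₂ z s t := fun z s t => (hsol ∅).mem₂.1 z s t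
  have hR₁ : condRateDistortion (pZ.map fun ω => (ω.1.1, ω.2)) d₁ D₁ ≤
      ((∑' z, massInfo (f₁ z) : ℝ) : EReal) :=
    condRateDistortion_le _ hC₁ hn₁
      (fun z s => ((hsol {z}).sum₁ z (Finset.mem_singleton_self z) s).trans (hP₁ s z).symm)
      fun F => by simpa using (hsol F).dist₁ F subset_rfl
  have hR₂ : condRateDistortion (pZ.map fun ω => (ω.1.2, ω.2)) d₂ D₂ ≤
      ((∑' z, massInfo (f₂ z) : ℝ) : EReal) :=
    condRateDistortion_le _ hC₂ hn₂
      (fun z s => ((hsol {z}).sum₂ z (Finset.mem_singleton_self z) s).trans (hP₂ s z).symm)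
      fun F => by simpa using (hsol F).dist₂ F subset_rfl
  have hI₁ : ∀ z, 0 ≤ massInfo (f₁ z) := fun z => massInfo_nonneg (hn₁ z)
  have hI₂ : ∀ z, 0 ≤ massInfo (f₂ z) := fun z => massInfo_nonneg (hn₂ z)
  refine ⟨k, pQ, hQ, ?_, ?_, ?_, ?_⟩
  · rw [e1]
    refine hR₁.trans (EReal.coe_le_coe_iff.2 ?_)
    exact Real.tsum_le_of_sum_le hI₁ fun F => (hsol F).rate₁ F subset_rfl
  · rw [e2]
    refine hR₂.trans (EReal.coe_le_coe_iff.2 ?_)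
    exact Real.tsum_le_of_sum_le hI₂ fun F => (hsol F).rate₂ F subset_rfl
  · rw [e3]
    refine (add_le_add hR₁ hR₂).trans ?_
    rw [← EReal.coe_add, EReal.coe_le_coe_iff]
    have h1 : ∀ F₂ : Finset Z, ∑' z, massInfo (f₁ z) ≤ v.2.2.1 - ∑ z ∈ F₂, massInfo (f₂ z) := by
      intro F₂
      refine Real.tsum_le_of_sum_le hI₁ fun F₁ => ?_
      have h := (hsol (F₁ ∪ F₂)).rate _ subset_rfl
      have h₁ : ∑ z ∈ F₁, massInfo (f₁ z) ≤ ∑ z ∈ F₁ ∪ F₂, massInfo (f₁ z) :=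
        Finset.sum_le_sum_of_subset_of_nonneg Finset.subset_union_left fun z _ _ => hI₁ z
      have h₂ : ∑ z ∈ F₂, massInfo (f₂ z) ≤ ∑ z ∈ F₁ ∪ F₂, massInfo (f₂ z) :=
        Finset.sum_le_sum_of_subset_of_nonneg Finset.subset_union_right fun z _ _ => hI₂ z
      linarith
    have h2 : ∑' z, massInfo (f₂ z) ≤ v.2.2.1 - ∑' z, massInfo (f₁ z) :=
      Real.tsum_le_of_sum_le hI₂ fun F₂ => by linarith [h1 F₂]
    linarith
  · rw [e4]
    refine (jointRateDistortion_le p (fun s t => (hsol ∅).memJoint.1 s t) (hsol ∅).sum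
      (by simpa using (hsol ∅).distJoint₁) (by simpa using (hsol ∅).distJoint₂)).trans
      (EReal.coe_le_coe_iff.2 (hsol ∅).rateJoint)
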